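/- Let $(\Omega,\mathcal F,P)$ be a probability space, $\mathbb K\in\{\mathbb R,\mathbb C\}$, and let $L^0(\mathcal F,\mathbb K)$ be the algebra of equivalence classes (modulo $P$-a.s. equality) of $\mathbb K$-valued random variables, $L^0_+(\mathcal F)=\{\zeta\in L^0(\mathcal F,\mathbb R):\zeta\ge 0\}$. Let $(S,\|\cdot\|)$ be a random normed module over $\mathbb K$ with base $(\Omega,\mathcal F,P)$: a left $L^0(\mathcal F,\mathbb K)$-module with a map $\|\cdot\|:S\to L^0_+(\mathcal F)$ such that $\|x\|=0\Rightarrow x=0$, $\|\zeta x\|=|\zeta|\,\|x\|$ and $\|x+y\|\le\|x\|+\|y\|$. Give $S$ the $(\varepsilon,\lambda)$-topology, the linear topology with local base $\{z: P(\|z\|<\varepsilon)>1-\lambda\}$ ($\varepsilon>0$, $0<\lambda<1$) at $0$, and assume that $S$ is complete; all limits in $S$ are taken in this topology. Let $B(S)$ be the set of $\mathbb K$-linear maps $T:S\to S$ that are almost surely bounded, i.e. $\|Tx\|\le\zeta\|x\|$ for all $x\in S$ and some $\zeta\in L^0_+(\mathcal F)$; $\|T\|$ is the infimum in $L^0(\mathcal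 F,\mathbb R)$ of all such $\zeta$. Let $C\in B(S)$ be injective, with range $R(C)$, and let $\{W(s):s\ge0\}\subset B(S)$ be a $C$-semigroup: $CW(s+t)=W(t)W(s)$ for all $s,t\ge0$, $W(0)=C$, and $s\mapsto W(s)x$ is continuous on $[0,\infty)$ for every $x\in S$. Assume that $\{W(s)\}\in H(M,\xi)$, that is, $\|W(s)\|\le Me^{\xi s}$ for all $s\ge0$, where $M\in L^0_+(\mathcal F)$ and $\xi\in L^0(\mathcal F,\mathbb R)$. Let $(A,D(A))$ be its infinitesimal generator: $$D(A)=\Big\{x\in S:\ \lim_{s\downarrow0}\tfrac{W(s)x-Cx}{s}\ \text{exists and belongs to } R(C)\Big\},\qquad Ax=C^{-1}\lim_{s\downarrow0}\tfrac{W(s)x-Cx}{s}.$$ Then for every $\eta\in G_\xi=\{\eta\in L^0(\mathcal F,\mathbb R):\eta>\xi\ \text{a.s.}\}$, $\eta$ lies in the $C$-resolvent set $\rho_C(A)$, that is, $\eta-A:D(A)\to S$ is injective and $R(C)\subseteq R(\eta-A)$; and the $C$-resolvent $R_C(\eta,A)=(\eta-A)^{-1}C$ satisfies $$R_C(\eta,A)x=\int_0^\infty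 e^{-\eta s}W(s)x\,ds\qquad\text{for all }x\in S,$$ where the integral exists as the limit, as $b\to\infty$, of the $S$-valued Riemann integrals over $[0,b]$. -/

import Mathlib

open MeasureTheory Filter Topology
open scoped NNReal

noncomputable section

namespace RandomModule

/-! ### The algebra `L⁰(F, 𝕜)` -/

/-- The space `L⁰(F, 𝕜)` of equivalence classes of `𝕜`-valued random variables. -/
abbrev L0 {Ω : Type*} [MeasurableSpace Ω] (P : Measure Ω) (𝕜 : Type*) [RCLike 𝕜] : Type _ :=
  Ω →ₘ[P] 𝕜

section L0

variable {Ω : Type*} [MeasurableSpace Ω] {P : Measure Ω} {𝕜 : Type*} [RCLike 𝕜]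

/-- `L⁰(F, 𝕜)` is a commutative ring under the pointwise operations. -/
instance L0.instCommRing : CommRing (L0 P 𝕜) where
  __ := (inferInstance : AddCommGroup (Ω →ₘ[P] 𝕜))
  __ := (inferInstance : CommMonoid (Ω →ₘ[P] 𝕜))
  left_distrib a b c := by
    apply AEEqFun.ext
    filter_upwards [AEEqFun.coeFn_mul a (b + c), AEEqFun.coeFn_add b c,
      AEEqFun.coeFn_add (a * b) (a * c), AEEqFun.coeFn_mul a b, AEEqFun.coeFn_mul a c]
      with ω h1 h2 h3 h4 h5
    rw [h1, h3, Pi.mul_apply, Pi.add_apply, h2, h4, h5]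
    simp [mul_add]
  right_distrib a b c := by
    apply AEEqFun.ext
    filter_upwards [AEEqFun.coeFn_mul (a + b) c, AEEqFun.coeFn_add a b,
      AEEqFun.coeFn_add (a * c) (b * c), AEEqFun.coeFn_mul a c, AEEqFun.coeFn_mul b c]
      with ω h1 h2 h3 h4 h5
    rw [h1, h3, Pi.mul_apply, Pi.add_apply, h2, h4, h5]
    simp [add_mul]
  zero_mul a := by
    apply AEEqFun.ext
    filter_upwards [AEEqFun.coeFn_mul 0 a, AEEqFun.coeFn_zero (μ := P) (β := 𝕜)] with ω h1 h2
    rw [h1, Pi.mul_apply, h2]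
    simp
  mul_zero a := by
    apply AEEqFun.ext
    filter_upwards [AEEqFun.coeFn_mul a 0, AEEqFun.coeFn_zero (μ := P) (β := 𝕜)] with ω h1 h2
    rw [h1, Pi.mul_apply, h2]
    simp

/-- The constant random variable with value `c`. -/
def L0.const (P : Measure Ω) (c : 𝕜) : L0 P 𝕜 := AEEqFun.const Ω c

/-- The absolute value `|ζ| ∈ L⁰(F, ℝ)` of `ζ ∈ L⁰(F, 𝕜)`. -/
def L0.abs (ζ : L0 P 𝕜) : L0 P ℝ := AEEqFun.comp (fun z : 𝕜 => ‖z‖) continuous_norm ζ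

/-- The exponential of a real random variable. -/
def L0.exp (ζ : L0 P ℝ) : L0 P ℝ := AEEqFun.comp Real.exp Real.continuous_exp ζ

/-- The inclusion of `L⁰(F, ℝ)` into `L⁰(F, 𝕜)`. -/
def L0.ofReal (𝕜 : Type*) [RCLike 𝕜] (ζ : L0 P ℝ) : L0 P 𝕜 :=
  AEEqFun.comp (fun r : ℝ => (r : 𝕜)) RCLike.continuous_ofReal ζ

/-- `G_ξ = {η ∈ L⁰(F, ℝ) : η > ξ on Ω}`. -/
def L0.G (ξ : L0 P ℝ) : Set (L0 P ℝ) := {η | ∀ᵐ ω ∂P, ξ ω < η ω}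

theorem L0.coeFn_abs (ζ : L0 P 𝕜) : ∀ᵐ ω ∂P, L0.abs ζ ω = ‖ζ ω‖ :=
  AEEqFun.coeFn_comp _ _ _

theorem L0.coeFn_mul (a b : L0 P 𝕜) : ∀ᵐ ω ∂P, (a * b) ω = a ω * b ω :=
  AEEqFun.coeFn_mul a b

theorem L0.coeFn_add (a b : L0 P 𝕜) : ∀ᵐ ω ∂P, (a + b) ω = a ω + b ω :=
  AEEqFun.coeFn_add a b

theorem L0.coeFn_sub (a b : L0 P 𝕜) : ∀ᵐ ω ∂P, (a - b) ω = a ω - b ω :=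
  AEEqFun.coeFn_sub a b

theorem L0.coeFn_zero : ∀ᵐ ω ∂P, (0 : L0 P 𝕜) ω = 0 :=
  AEEqFun.coeFn_zero

theorem L0.le_iff (a b : L0 P ℝ) : a ≤ b ↔ ∀ᵐ ω ∂P, a ω ≤ b ω :=
  AEEqFun.coeFn_le.symm

theorem L0.abs_mul (a b : L0 P 𝕜) : L0.abs (a * b) = L0.abs a * L0.abs b := by
  apply AEEqFun.ext
  filter_upwards [L0.coeFn_abs (a * b), L0.coeFn_abs a, L0.coeFn_abs b, L0.coeFn_mul a b,
    L0.coeFn_mul (L0.abs a) (L0.abs b)] with ω h1 h2 h3 h4 h5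
  rw [h1, h5, h2, h3, h4, norm_mul]

theorem L0.abs_zero : L0.abs (0 : L0 P 𝕜) = 0 := by
  apply AEEqFun.ext
  filter_upwards [L0.coeFn_abs (0 : L0 P 𝕜), L0.coeFn_zero (P := P) (𝕜 := 𝕜),
    L0.coeFn_zero (P := P) (𝕜 := ℝ)] with ω h1 h2 h3
  rw [h1, h3, h2, norm_zero]

theorem L0.abs_nonneg (a : L0 P 𝕜) : 0 ≤ L0.abs a := by
  rw [L0.le_iff]
  filter_upwards [L0.coeFn_abs a, L0.coeFn_zero (P := P) (𝕜 := ℝ)] with ω h1 h3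
  rw [h1, h3]
  exact norm_nonneg _

theorem L0.mul_le_mul_left {a b c : L0 P ℝ} (ha : 0 ≤ a) (h : b ≤ c) : a * b ≤ a * c := by
  rw [L0.le_iff] at *
  filter_upwards [ha, h, L0.coeFn_zero (P := P) (𝕜 := ℝ), L0.coeFn_mul a b, L0.coeFn_mul a c]
    with ω h1 h2 h3 h4 h5
  rw [h4, h5]
  rw [h3] at h1
  exact mul_le_mul_of_nonneg_left h2 h1

theorem L0.add_le_add_right {a b : L0 P ℝ} (h : a ≤ b) (c : L0 P ℝ) : a + c ≤ b + c := by
  rw [L0.le_iff] at *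
  filter_upwards [h, L0.coeFn_add a c, L0.coeFn_add b c] with ω h2 h4 h5
  rw [h4, h5]
  linarith

/-- A nonempty subset of `L⁰₊(F)` that is stable under binary infima has an infimum. -/
theorem L0.exists_isGLB [IsProbabilityMeasure P] (B : Set (L0 P ℝ)) (hne : B.Nonempty)
    (h0 : ∀ a ∈ B, 0 ≤ a) (hinf : ∀ a ∈ B, ∀ b ∈ B, a ⊓ b ∈ B) : ∃ N, IsGLB B N := by
  -- an increasing bounded functional on `L⁰₊`
  let φ : L0 P ℝ → ℝ := fun a => ∫ ω, Real.arctan (a ω) ∂P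
  have hint : ∀ a : L0 P ℝ, Integrable (fun ω => Real.arctan (a ω)) P := by
    intro a
    refine Integrable.of_bound
      (Real.continuous_arctan.comp_aestronglyMeasurable a.aestronglyMeasurable) (Real.pi / 2) ?_
    filter_upwards with ω
    rw [Real.norm_eq_abs, _root_.abs_le]
    exact ⟨(Real.neg_pi_div_two_lt_arctan _).le, (Real.arctan_lt_pi_div_two _).le⟩
  have hmono : ∀ a b : L0 P ℝ, a ≤ b → φ a ≤ φ b := by
    intro a b hab
    refine integral_mono_ae (hint a) (hint b) ?_
    filter_upwards [(L0.le_iff a b).1 hab] with ω h using Real.arctan_strictMono.monotone h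
  have hzero : ∀ a ∈ B, 0 ≤ φ a := by
    intro a ha
    refine integral_nonneg_of_ae ?_
    filter_upwards [(L0.le_iff 0 a).1 (h0 a ha), L0.coeFn_zero (P := P) (𝕜 := ℝ)] with ω h h'
    rw [h'] at h
    simpa using Real.arctan_nonneg.2 h
  have hbdd : BddBelow (φ '' B) := ⟨0, by rintro _ ⟨a, ha, rfl⟩; exact hzero a ha⟩
  have hneφ : (φ '' B).Nonempty := hne.image φ
  set c := sInf (φ '' B) with hc
  have hex : ∀ n : ℕ, ∃ a ∈ B, φ a < c + 1 / ((n : ℝ) + 1) := by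
    intro n
    obtain ⟨_, ⟨a, ha, rfl⟩, h⟩ := exists_lt_of_csInf_lt hneφ
      (show sInf (φ '' B) < c + 1 / ((n : ℝ) + 1) by
        have : (0 : ℝ) < 1 / ((n : ℝ) + 1) := by positivity
        linarith)
    exact ⟨a, ha, h⟩
  choose u huB hu using hex
  let f : Ω → ℝ := fun ω => ⨅ n, u n ω
  have hf : Measurable f := Measurable.iInf fun n => (u n).measurable
  let N : L0 P ℝ := AEEqFun.mk f hf.aestronglyMeasurable
  have hN : ∀ᵐ ω ∂P, N ω = ⨅ n, u n ω := AEEqFun.coeFn_mk _ _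
  have hpos : ∀ᵐ ω ∂P, ∀ n, 0 ≤ u n ω := by
    rw [ae_all_iff]
    intro n
    filter_upwards [(L0.le_iff 0 _).1 (h0 _ (huB n)), L0.coeFn_zero (P := P) (𝕜 := ℝ)] with ω h h'
    rwa [h'] at h
  have hNle : ∀ n, N ≤ u n := by
    intro n
    rw [L0.le_iff]
    filter_upwards [hN, hpos] with ω h1 h2
    rw [h1]
    exact ciInf_le ⟨0, by rintro _ ⟨m, rfl⟩; exact h2 m⟩ n
  refine ⟨N, ?_, ?_⟩
  · intro b hb
    -- `v n` is the minimum of `u 0, …, u n`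
    let v : ℕ → L0 P ℝ := fun n => Nat.rec (u 0) (fun k a => a ⊓ u (k + 1)) n
    have hvB : ∀ n, v n ∈ B := by
      intro n
      induction n with
      | zero => exact huB 0
      | succ k ih => exact hinf _ ih _ (huB (k + 1))
    have hvu : ∀ n, v n ≤ u n := by
      intro n
      cases n with
      | zero => exact le_rfl
      | succ k => exact inf_le_right
    have hNv : ∀ n, N ≤ v n := by
      intro n
      induction n with
      | zero => exact hNle 0
      | succ k ih => exact le_inf ih (hNle (k + 1))
    have hvanti : Antitone v := antitone_nat_of_succ_le fun n => inf_le_left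
    have hlim : ∀ᵐ ω ∂P, Tendsto (fun n => v n ω) atTop (𝓝 (N ω)) := by
      have h1 : ∀ᵐ ω ∂P, ∀ n, v n ω ≤ u n ω :=
        ae_all_iff.2 fun n => (L0.le_iff _ _).1 (hvu n)
      have h2 : ∀ᵐ ω ∂P, ∀ n, N ω ≤ v n ω :=
        ae_all_iff.2 fun n => (L0.le_iff _ _).1 (hNv n)
      have h3 : ∀ᵐ ω ∂P, ∀ n, v (n + 1) ω ≤ v n ω :=
        ae_all_iff.2 fun n => (L0.le_iff _ _).1 (hvanti (Nat.le_succ n))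
      filter_upwards [h1, h2, h3, hN] with ω g1 g2 g3 g4
      have hb' : BddBelow (Set.range fun n => v n ω) :=
        ⟨N ω, by rintro _ ⟨m, rfl⟩; exact g2 m⟩
      have ht := tendsto_atTop_ciInf (antitone_nat_of_succ_le g3) hb'
      have he : (⨅ n, v n ω) = N ω := by
        apply le_antisymm
        · rw [g4]
          exact le_ciInf fun n => (ciInf_le hb' n).trans (g1 n)
        · exact le_ciInf g2
      rwa [he] at ht
    have hlimb : Tendsto (fun n => φ (v n ⊓ b)) atTop (𝓝 (φ (N ⊓ b))) := by
      refine tendsto_integral_of_dominated_convergence (fun _ => Real.pi / 2)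
        (fun n => (hint _).aestronglyMeasurable) (integrable_const _) (fun n => ?_) ?_
      · filter_upwards with ω
        rw [Real.norm_eq_abs, _root_.abs_le]
        exact ⟨(Real.neg_pi_div_two_lt_arctan _).le, (Real.arctan_lt_pi_div_two _).le⟩
      · have h1 : ∀ᵐ ω ∂P, ∀ n, (v n ⊓ b) ω = v n ω ⊓ b ω :=
          ae_all_iff.2 fun n => AEEqFun.coeFn_inf _ _
        filter_upwards [hlim, h1, AEEqFun.coeFn_inf N b] with ω g1 g2 g3
        rw [g3]
        simp only [g2]
        exact (Real.continuous_arctan.tendsto _).comp (g1.min tendsto_const_nhds)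
    have hge : c ≤ φ (N ⊓ b) :=
      ge_of_tendsto' hlimb fun n => csInf_le hbdd ⟨_, hinf _ (hvB n) _ hb, rfl⟩
    have hle : φ N ≤ c := by
      have h1 : Tendsto (fun n : ℕ => c + 1 / ((n : ℝ) + 1)) atTop (𝓝 (c + 0)) :=
        tendsto_const_nhds.add tendsto_one_div_add_atTop_nhds_zero_nat
      rw [add_zero] at h1
      exact ge_of_tendsto' h1 fun n => (hmono _ _ (hNle n)).trans (hu n).le
    have heq : φ (N ⊓ b) = φ N :=
      le_antisymm (hmono _ _ inf_le_left) (hle.trans hge)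
    have hae := (integral_eq_iff_of_ae_le (hint (N ⊓ b)) (hint N) (by
      filter_upwards [(L0.le_iff _ _).1 (inf_le_left : N ⊓ b ≤ N)] with ω h
        using Real.arctan_strictMono.monotone h)).1 heq
    have : N ⊓ b = N := by
      apply AEEqFun.ext
      filter_upwards [hae] with ω h using Real.arctan_strictMono.injective h
    rw [← this]
    exact inf_le_right
  · intro l hl
    rw [L0.le_iff]
    have h1 : ∀ᵐ ω ∂P, ∀ n, l ω ≤ u n ω :=
      ae_all_iff.2 fun n => (L0.le_iff _ _).1 (hl (huB n))
    filter_upwards [h1, hN] with ω g1 g2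
    rw [g2]
    exact le_ciInf g1

end L0

/-! ### Random normed modules and the `(ε, λ)`-topology -/

/-- A random normed module over `𝕜` with base `(Ω, F, P)`: a left module `S` over the algebra
`L⁰(F, 𝕜)` together with an `L⁰`-norm `S → L⁰₊(F)`. -/
class RandomNormedModule {Ω : Type*} [MeasurableSpace Ω] (P : Measure Ω) (𝕜 : Type*) [RCLike 𝕜]
    (S : Type*) [AddCommGroup S] [Module (L0 P 𝕜) S] where
  /-- the `L⁰`-norm; written `l0norm P 𝕜 x` below -/
  toFun : S → L0 P ℝ
  nonneg' : ∀ x, 0 ≤ toFun x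
  eq_zero' : ∀ x, toFun x = 0 → x = 0
  smul' : ∀ (ζ : L0 P 𝕜) (x : S), toFun (ζ • x) = L0.abs ζ * toFun x
  add_le' : ∀ x y, toFun (x + y) ≤ toFun x + toFun y

section Norm

variable {Ω : Type*} [MeasurableSpace Ω] (P : Measure Ω) (𝕜 : Type*) [RCLike 𝕜]
  {S : Type*} [AddCommGroup S] [Module (L0 P 𝕜) S] [RandomNormedModule P 𝕜 S]

/-- The `L⁰`-norm `‖x‖` of `x ∈ S`. -/
def l0norm (x : S) : L0 P ℝ := RandomNormedModule.toFun (P := P) 𝕜 x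

variable {P 𝕜}

theorem l0norm_nonneg (x : S) : 0 ≤ l0norm P 𝕜 x := RandomNormedModule.nonneg' x

theorem eq_zero_of_l0norm_eq_zero (x : S) (h : l0norm P 𝕜 x = 0) : x = 0 :=
  RandomNormedModule.eq_zero' x h

theorem l0norm_smul (ζ : L0 P 𝕜) (x : S) : l0norm P 𝕜 (ζ • x) = L0.abs ζ * l0norm P 𝕜 x :=
  RandomNormedModule.smul' ζ x

theorem l0norm_add_le (x y : S) : l0norm P 𝕜 (x + y) ≤ l0norm P 𝕜 x + l0norm P 𝕜 y :=
  RandomNormedModule.add_le' x y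

end Norm

section Topology

variable {Ω : Type*} [MeasurableSpace Ω] (P : Measure Ω) (𝕜 : Type*) [RCLike 𝕜]
  (S : Type*) [AddCommGroup S] [Module (L0 P 𝕜) S] [RandomNormedModule P 𝕜 S]

/-- The basic neighbourhood `U_θ(ε, λ) = {z : P(‖z‖ < ε) > 1 - λ}` of the null element. -/
def elBall (ε lam : ℝ) : Set S :=
  {z | 1 - lam < P.real {ω | l0norm P 𝕜 z ω < ε}}

variable {S} in
theorem l0norm_zero : l0norm P 𝕜 (0 : S) = 0 := by
  have h := l0norm_smul (P := P) (𝕜 := 𝕜) (S := S) 0 0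
  rwa [L0.abs_zero, zero_smul, zero_mul] at h

variable {S} in
theorem l0norm_neg (x : S) : l0norm P 𝕜 (-x) = l0norm P 𝕜 x := by
  have h := l0norm_smul (P := P) (𝕜 := 𝕜) (S := S) (-1) x
  have h1 : L0.abs (-1 : L0 P 𝕜) = 1 := by
    apply AEEqFun.ext
    filter_upwards [L0.coeFn_abs (-1 : L0 P 𝕜), AEEqFun.coeFn_neg (1 : L0 P 𝕜),
      AEEqFun.coeFn_one (μ := P) (β := 𝕜), AEEqFun.coeFn_one (μ := P) (β := ℝ)] with ω g1 g2 g3 g4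
    rw [g1, g2, g4, Pi.neg_apply, g3]
    simp
  rwa [h1, neg_smul, one_smul, one_mul] at h

variable [IsProbabilityMeasure P]

variable {S} in
theorem zero_mem_elBall {ε lam : ℝ} (hε : 0 < ε) (hl : 0 < lam) :
    (0 : S) ∈ elBall P 𝕜 S ε lam := by
  have h : P.real {ω | l0norm P 𝕜 (0 : S) ω < ε} = P.real Set.univ := by
    apply measureReal_congr
    filter_upwards [L0.coeFn_zero (P := P) (𝕜 := ℝ)] with ω h0
    apply propext
    refine ⟨fun _ => trivial, fun _ => ?_⟩
    change l0norm P 𝕜 (0 : S) ω < ε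
    rw [l0norm_zero, h0]
    exact hε
  change 1 - lam < _
  rw [h, probReal_univ]
  linarith

theorem elBall_mono {ε₁ ε₂ l₁ l₂ : ℝ} (hε : ε₁ ≤ ε₂) (hl : l₁ ≤ l₂) :
    elBall P 𝕜 S ε₁ l₁ ⊆ elBall P 𝕜 S ε₂ l₂ := by
  intro z hz
  have hz' : 1 - l₁ < P.real {ω | l0norm P 𝕜 z ω < ε₁} := hz
  change 1 - l₂ < P.real {ω | l0norm P 𝕜 z ω < ε₂}
  have : P.real {ω | l0norm P 𝕜 z ω < ε₁} ≤ P.real {ω | l0norm P 𝕜 z ω < ε₂} :=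
    measureReal_mono fun ω (h : _ < _) => h.trans_le hε
  linarith

variable {S} in
theorem add_mem_elBall {ε lam : ℝ} {x y : S} (hx : x ∈ elBall P 𝕜 S (ε / 2) (lam / 2))
    (hy : y ∈ elBall P 𝕜 S (ε / 2) (lam / 2)) : x + y ∈ elBall P 𝕜 S ε lam := by
  have hx' : 1 - lam / 2 < P.real {ω | l0norm P 𝕜 x ω < ε / 2} := hx
  have hy' : 1 - lam / 2 < P.real {ω | l0norm P 𝕜 y ω < ε / 2} := hy
  change 1 - lam < P.real {ω | l0norm P 𝕜 (x + y) ω < ε}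
  have hm : MeasurableSet {ω | l0norm P 𝕜 y ω < ε / 2} :=
    measurableSet_lt (l0norm P 𝕜 y).measurable measurable_const
  have h1 := measureReal_union_add_inter (μ := P) (s := {ω | l0norm P 𝕜 x ω < ε / 2}) hm
  have h2 : P.real ({ω | l0norm P 𝕜 x ω < ε / 2} ∪ {ω | l0norm P 𝕜 y ω < ε / 2}) ≤ 1 :=
    measureReal_le_one
  have h3 : P.real ({ω | l0norm P 𝕜 x ω < ε / 2} ∩ {ω | l0norm P 𝕜 y ω < ε / 2}) ≤
      P.real {ω | l0norm P 𝕜 (x + y) ω < ε} := by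
    refine ENNReal.toReal_mono (measure_ne_top _ _) (measure_mono_ae ?_)
    filter_upwards [(L0.le_iff _ _).1 (l0norm_add_le (P := P) (𝕜 := 𝕜) x y),
      L0.coeFn_add (l0norm P 𝕜 x) (l0norm P 𝕜 y)] with ω g1 g2 g3
    rw [g2] at g1
    have g4 : l0norm P 𝕜 x ω < ε / 2 := g3.1
    have g5 : l0norm P 𝕜 y ω < ε / 2 := g3.2
    change l0norm P 𝕜 (x + y) ω < ε
    linarith
  linarith

/-- The sets `U_θ(ε, λ)`, `ε > 0`, `0 < λ < 1`, form a base at `θ` of a group topology. -/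
@[reducible]
def elBasis : AddGroupFilterBasis S where
  sets := {U | ∃ ε lam : ℝ, 0 < ε ∧ 0 < lam ∧ lam < 1 ∧ U = elBall P 𝕜 S ε lam}
  nonempty := ⟨_, 1, 1 / 2, by norm_num, by norm_num, by norm_num, rfl⟩
  inter_sets := by
    rintro _ _ ⟨ε₁, l₁, h1, h2, h3, rfl⟩ ⟨ε₂, l₂, g1, g2, g3, rfl⟩
    refine ⟨_, ⟨min ε₁ ε₂, min l₁ l₂, lt_min h1 g1, lt_min h2 g2,
      (min_le_left _ _).trans_lt h3, rfl⟩, Set.subset_inter ?_ ?_⟩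
    · exact elBall_mono P 𝕜 S (min_le_left _ _) (min_le_left _ _)
    · exact elBall_mono P 𝕜 S (min_le_right _ _) (min_le_right _ _)
  zero' := by
    rintro _ ⟨ε, l, h1, h2, h3, rfl⟩
    exact zero_mem_elBall P 𝕜 h1 h2
  add' := by
    rintro _ ⟨ε, l, h1, h2, h3, rfl⟩
    refine ⟨_, ⟨ε / 2, l / 2, by linarith, by linarith, by linarith, rfl⟩, ?_⟩
    rintro _ ⟨x, hx, y, hy, rfl⟩
    exact add_mem_elBall P 𝕜 hx hy
  neg' := by
    rintro _ ⟨ε, l, h1, h2, h3, rfl⟩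
    refine ⟨_, ⟨ε, l, h1, h2, h3, rfl⟩, ?_⟩
    intro x hx
    change 1 - l < P.real {ω | l0norm P 𝕜 (-x) ω < ε}
    rw [l0norm_neg]
    exact hx
  conj' := by
    rintro x₀ _ ⟨ε, l, h1, h2, h3, rfl⟩
    refine ⟨_, ⟨ε, l, h1, h2, h3, rfl⟩, ?_⟩
    intro x hx
    simpa using hx

/-- The `(ε, λ)`-topology on a random normed module. -/
@[reducible]
def elTopology : TopologicalSpace S := (elBasis P 𝕜 S).topology

theorem elTopology_isTopologicalAddGroup :
    @IsTopologicalAddGroup S (elTopology P 𝕜 S) _ :=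
  (elBasis P 𝕜 S).isTopologicalAddGroup

/-- The translation-invariant uniform structure of the `(ε, λ)`-topology. -/
@[reducible]
def elUniformSpace : UniformSpace S :=
  @IsTopologicalAddGroup.rightUniformSpace S _ (elTopology P 𝕜 S)
    (elTopology_isTopologicalAddGroup P 𝕜 S)

/-- Completeness with respect to the `(ε, λ)`-topology. -/
def IsELComplete : Prop := @CompleteSpace S (elUniformSpace P 𝕜 S)

variable {S}

/-- Convergence in the `(ε, λ)`-topology. -/
def ELTendsto {ι : Type*} (f : ι → S) (l : Filter ι) (x : S) : Prop :=
  Tendsto f l (@nhds S (elTopology P 𝕜 S) x)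

theorem elTendsto_iff {ι : Type*} (f : ι → S) (l : Filter ι) (x : S) :
    ELTendsto P 𝕜 f l x ↔ ∀ ε lam : ℝ, 0 < ε → 0 < lam → lam < 1 →
      ∀ᶠ i in l, f i - x ∈ elBall P 𝕜 S ε lam := by
  unfold ELTendsto
  rw [((elBasis P 𝕜 S).nhds_hasBasis x).tendsto_right_iff]
  have key : ∀ (V : Set S) (y : S), y ∈ (fun y => x + y) '' V ↔ y - x ∈ V := by
    intro V y
    constructor
    · rintro ⟨z, hz, rfl⟩
      simpa using hz
    · intro h
      exact ⟨y - x, h, by simp⟩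
  simp only [key]
  constructor
  · intro h ε lam h1 h2 h3
    exact h _ ⟨ε, lam, h1, h2, h3, rfl⟩
  · rintro h _ ⟨ε, lam, h1, h2, h3, rfl⟩
    exact h ε lam h1 h2 h3

variable {P 𝕜} in
theorem ELTendsto.add {ι : Type*} {f g : ι → S} {l : Filter ι} {x y : S}
    (hf : ELTendsto P 𝕜 f l x) (hg : ELTendsto P 𝕜 g l y) :
    ELTendsto P 𝕜 (fun i => f i + g i) l (x + y) := by
  let _ := elTopology P 𝕜 S
  have := elTopology_isTopologicalAddGroup P 𝕜 S
  exact Tendsto.add hf hg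

variable {P 𝕜} in
theorem ELTendsto.smul {ι : Type*} {f : ι → S} {l : Filter ι} {x : S}
    (hf : ELTendsto P 𝕜 f l x) (ζ : L0 P 𝕜) :
    ELTendsto P 𝕜 (fun i => ζ • f i) l (ζ • x) := by
  rw [elTendsto_iff] at hf ⊢
  intro ε lam hε hl hl1
  -- `|ζ| ≤ k` with probability close to one
  have hk : ∃ k : ℕ, P.real {ω | (k : ℝ) < L0.abs ζ ω} < lam / 2 := by
    have hanti : Antitone fun k : ℕ => {ω | (k : ℝ) < L0.abs ζ ω} := by
      intro a b hab ω (h : (b : ℝ) < _)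
      exact lt_of_le_of_lt (by exact_mod_cast hab) h
    have ht := tendsto_measure_iInter_atTop (μ := P)
      (fun k : ℕ => (measurableSet_lt (measurable_const (a := (k : ℝ)))
        (L0.abs ζ).measurable).nullMeasurableSet) hanti ⟨0, measure_ne_top _ _⟩
    have he : (⋂ k : ℕ, {ω | (k : ℝ) < L0.abs ζ ω}) = ∅ := by
      ext ω
      simp only [Set.mem_iInter, Set.mem_ofPred_eq, Set.mem_empty_iff_false, iff_false, not_forall,
        not_lt]
      exact exists_nat_ge _
    rw [he, measure_empty] at ht
    have ht' := (ENNReal.tendsto_toReal ENNReal.zero_ne_top).comp ht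
    exact (ht'.eventually (gt_mem_nhds (by simpa using half_pos hl))).exists
  obtain ⟨k, hk⟩ := hk
  have hk1 : (0 : ℝ) < (k : ℝ) + 1 := by positivity
  filter_upwards [hf (ε / (k + 1)) (lam / 2) (by positivity) (by linarith) (by linarith)] with i hi
  have hi' : 1 - lam / 2 < P.real {ω | l0norm P 𝕜 (f i - x) ω < ε / (k + 1)} := hi
  change 1 - lam < P.real {ω | l0norm P 𝕜 (ζ • f i - ζ • x) ω < ε}
  have h1 : P.real {ω | l0norm P 𝕜 (f i - x) ω < ε / (k + 1)} ≤
      P.real ({ω | l0norm P 𝕜 (ζ • f i - ζ • x) ω < ε} ∪ {ω | (k : ℝ) < L0.abs ζ ω}) := by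
    refine ENNReal.toReal_mono (measure_ne_top _ _) (measure_mono_ae ?_)
    have hs := l0norm_smul (P := P) (𝕜 := 𝕜) ζ (f i - x)
    rw [smul_sub] at hs
    filter_upwards [L0.coeFn_mul (L0.abs ζ) (l0norm P 𝕜 (f i - x)),
      (L0.le_iff _ _).1 (l0norm_nonneg (P := P) (𝕜 := 𝕜) (f i - x)),
      L0.coeFn_zero (P := P) (𝕜 := ℝ)] with ω g1 g2 g3 g4
    rw [g3] at g2
    have g4 : l0norm P 𝕜 (f i - x) ω < ε / (k + 1) := g4
    by_cases hb : (k : ℝ) < L0.abs ζ ω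
    · exact Or.inr hb
    · left
      change l0norm P 𝕜 (ζ • f i - ζ • x) ω < ε
      rw [hs, g1]
      push Not at hb
      rw [lt_div_iff₀ hk1] at g4
      nlinarith
  have h2 := measureReal_union_le (μ := P) {ω | l0norm P 𝕜 (ζ • f i - ζ • x) ω < ε}
    {ω | (k : ℝ) < L0.abs ζ ω}
  linarith

variable {P 𝕜} in
theorem ELTendsto.unique {ι : Type*} {f : ι → S} {l : Filter ι} [l.NeBot] {x y : S}
    (hx : ELTendsto P 𝕜 f l x) (hy : ELTendsto P 𝕜 f l y) : x = y := by
  have h0 : ∀ ε lam : ℝ, 0 < ε → 0 < lam → lam < 1 → x - y ∈ elBall P 𝕜 S ε lam := by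
    intro ε lam h1 h2 h3
    rw [elTendsto_iff] at hx hy
    obtain ⟨i, hi1, hi2⟩ := ((hx (ε / 2) (lam / 2) (by linarith) (by linarith) (by linarith)).and
      (hy (ε / 2) (lam / 2) (by linarith) (by linarith) (by linarith))).exists
    have hi1' : x - f i ∈ elBall P 𝕜 S (ε / 2) (lam / 2) := by
      rw [← neg_sub]
      change 1 - lam / 2 < P.real {ω | l0norm P 𝕜 (-(f i - x)) ω < ε / 2}
      rw [l0norm_neg]
      exact hi1
    simpa using add_mem_elBall P 𝕜 hi1' hi2
  rw [← sub_eq_zero]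
  refine eq_zero_of_l0norm_eq_zero (P := P) (𝕜 := 𝕜) _ (AEEqFun.ext ?_)
  have h1 : ∀ n : ℕ, ∀ᵐ ω ∂P, l0norm P 𝕜 (x - y) ω < 1 / ((n : ℝ) + 1) := by
    intro n
    have hm : MeasurableSet {ω | l0norm P 𝕜 (x - y) ω < 1 / ((n : ℝ) + 1)} :=
      measurableSet_lt (l0norm P 𝕜 (x - y)).measurable measurable_const
    have h2 : P.real {ω | l0norm P 𝕜 (x - y) ω < 1 / ((n : ℝ) + 1)} = 1 := by
      apply le_antisymm measureReal_le_one
      by_contra hlt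
      push Not at hlt
      set p := P.real {ω | l0norm P 𝕜 (x - y) ω < 1 / ((n : ℝ) + 1)} with hp
      have hp0 : 0 ≤ p := measureReal_nonneg
      have h3 : 1 - (1 - p) / 2 < p :=
        h0 (1 / ((n : ℝ) + 1)) ((1 - p) / 2) (by positivity) (by linarith) (by linarith)
      linarith
    have h4 : P {ω | l0norm P 𝕜 (x - y) ω < 1 / ((n : ℝ) + 1)} = 1 := by
      rw [Measure.real, ENNReal.toReal_eq_one_iff] at h2
      exact h2
    exact (mem_ae_iff_prob_eq_one hm).2 h4
  filter_upwards [ae_all_iff.2 h1, L0.coeFn_zero (P := P) (𝕜 := ℝ),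
    (L0.le_iff _ _).1 (l0norm_nonneg (P := P) (𝕜 := 𝕜) (x - y))] with ω g1 g2 g3
  rw [g2] at g3 ⊢
  refine le_antisymm ?_ g3
  exact ge_of_tendsto' tendsto_one_div_add_atTop_nhds_zero_nat fun n => (g1 n).le

end Topology

/-! ### Almost surely bounded linear operators -/

/-- The space `B(S)` of almost surely bounded `𝕜`-linear operators on `S`; the scalar field acts
through the constant random variables. -/
structure BoundedOperator {Ω : Type*} [MeasurableSpace Ω] (P : Measure Ω) (𝕜 : Type*) [RCLike 𝕜]
    (S : Type*) [AddCommGroup S] [Module (L0 P 𝕜) S] [RandomNormedModule P 𝕜 S]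
    extends S →+ S where
  map_const_smul' : ∀ (c : 𝕜) (x : S), toFun (L0.const P c • x) = L0.const P c • toFun x
  bounded' : ∃ N : L0 P ℝ, 0 ≤ N ∧ ∀ x, l0norm P 𝕜 (toFun x) ≤ N * l0norm P 𝕜 x

namespace BoundedOperator

variable {Ω : Type*} [MeasurableSpace Ω] {P : Measure Ω} {𝕜 : Type*} [RCLike 𝕜]
  {S : Type*} [AddCommGroup S] [Module (L0 P 𝕜) S] [RandomNormedModule P 𝕜 S]

instance instFunLike : FunLike (BoundedOperator P 𝕜 S) S S where
  coe T := T.toFun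
  coe_injective := by
    rintro ⟨f, _, _⟩ ⟨g, _, _⟩ h
    congr
    exact DFunLike.coe_injective h

/-- The almost sure bounds of `T`. -/
def bounds (T : BoundedOperator P 𝕜 S) : Set (L0 P ℝ) :=
  {N | 0 ≤ N ∧ ∀ x, l0norm P 𝕜 (T x) ≤ N * l0norm P 𝕜 x}

theorem exists_isGLB_bounds [IsProbabilityMeasure P] (T : BoundedOperator P 𝕜 S) :
    ∃ N, IsGLB T.bounds N := by
  refine L0.exists_isGLB _ T.bounded' (fun a ha => ha.1) ?_
  intro a ha b hb
  refine ⟨le_inf ha.1 hb.1, fun x => ?_⟩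
  rw [L0.le_iff]
  filter_upwards [(L0.le_iff _ _).1 (ha.2 x), (L0.le_iff _ _).1 (hb.2 x),
    L0.coeFn_mul a (l0norm P 𝕜 x), L0.coeFn_mul b (l0norm P 𝕜 x),
    L0.coeFn_mul (a ⊓ b) (l0norm P 𝕜 x), AEEqFun.coeFn_inf a b] with ω h1 h2 h3 h4 h5 h6
  rw [h5, h6]
  rw [h3] at h1
  rw [h4] at h2
  rcases min_choice (a ω) (b ω) with h | h <;> rw [h] <;> assumption

/-- The `L⁰`-norm of an almost surely bounded operator: the infimum in `L⁰(F, ℝ)` of its almost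
sure bounds. -/
def opNorm [IsProbabilityMeasure P] (T : BoundedOperator P 𝕜 S) : L0 P ℝ :=
  Classical.choose T.exists_isGLB_bounds

theorem isGLB_opNorm [IsProbabilityMeasure P] (T : BoundedOperator P 𝕜 S) :
    IsGLB T.bounds T.opNorm :=
  Classical.choose_spec T.exists_isGLB_bounds

theorem map_add (T : BoundedOperator P 𝕜 S) (x y : S) : T (x + y) = T x + T y :=
  T.map_add' x y

theorem map_zero (T : BoundedOperator P 𝕜 S) : T 0 = 0 := T.map_zero'

theorem map_sub (T : BoundedOperator P 𝕜 S) (x y : S) : T (x - y) = T x - T y :=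
  T.toAddMonoidHom.map_sub x y

/-- An almost surely bounded linear operator is a module homomorphism. -/
theorem map_smul (T : BoundedOperator P 𝕜 S) (ζ : L0 P 𝕜) (x : S) : T (ζ • x) = ζ • T x := by
  obtain ⟨N, hN0, hN⟩ := T.bounded'
  have hN : ∀ x, l0norm P 𝕜 (T x) ≤ N * l0norm P 𝕜 x := hN
  -- disjointly supported scalars
  have hdisj : ∀ (e f : L0 P 𝕜) (x : S), f * e = 0 → f • T (e • x) = 0 := by
    intro e f x hfe
    refine eq_zero_of_l0norm_eq_zero (P := P) (𝕜 := 𝕜) _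
      (le_antisymm ?_ (l0norm_nonneg (P := P) (𝕜 := 𝕜) _))
    rw [l0norm_smul]
    refine (L0.mul_le_mul_left (L0.abs_nonneg f) (hN _)).trans (le_of_eq ?_)
    rw [l0norm_smul]
    have : L0.abs f * L0.abs e = 0 := by rw [← L0.abs_mul, hfe, L0.abs_zero]
    calc L0.abs f * (N * (L0.abs e * l0norm P 𝕜 x))
        = (L0.abs f * L0.abs e) * (N * l0norm P 𝕜 x) := by ring
      _ = 0 := by rw [this, zero_mul]
  have hidem : ∀ (e : L0 P 𝕜) (x : S), e * e = e → T (e • x) = e • T x := by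
    intro e x he
    have h1 := hdisj e (1 - e) x (by rw [sub_mul, one_mul, he, sub_self])
    have h2 := hdisj (1 - e) e x (by rw [mul_sub, mul_one, he, sub_self])
    rw [sub_smul, one_smul, sub_eq_zero] at h1
    rw [sub_smul, one_smul, map_sub, smul_sub, sub_eq_zero] at h2
    rw [h1, ← h2]
  have hsimple : ∀ (g : SimpleFunc Ω 𝕜) (x : S),
      T ((AEEqFun.mk g g.aestronglyMeasurable : L0 P 𝕜) • x) =
        (AEEqFun.mk g g.aestronglyMeasurable : L0 P 𝕜) • T x := by
    intro g
    induction g using SimpleFunc.induction with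
    | @const c s hs =>
      intro x
      let e : L0 P 𝕜 := AEEqFun.mk (s.indicator fun _ => (1 : 𝕜))
        ((measurable_const.indicator hs).aestronglyMeasurable)
      have he1 : ∀ᵐ ω ∂P, e ω = s.indicator (fun _ => (1 : 𝕜)) ω := AEEqFun.coeFn_mk _ _
      have he : e * e = e := by
        apply AEEqFun.ext
        filter_upwards [L0.coeFn_mul e e, he1] with ω h1 h2
        rw [h1, h2]
        by_cases h : ω ∈ s <;> simp [h]
      have hc : (AEEqFun.mk _ (SimpleFunc.aestronglyMeasurable
          (SimpleFunc.piecewise s hs (SimpleFunc.const Ω c) (SimpleFunc.const Ω 0))) : L0 P 𝕜) =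
          L0.const P c * e := by
        apply AEEqFun.ext
        filter_upwards [L0.coeFn_mul (L0.const P c) e, he1,
          AEEqFun.coeFn_const Ω (μ := P) c, AEEqFun.coeFn_mk (μ := P) _
            (SimpleFunc.aestronglyMeasurable (SimpleFunc.piecewise s hs (SimpleFunc.const Ω c)
              (SimpleFunc.const Ω 0)))] with ω h1 h2 h3 h4
        rw [h1, h2, h4]
        have h3' : L0.const P c ω = c := h3
        rw [h3']
        by_cases h : ω ∈ s <;> simp [h]
      rw [hc, mul_smul, mul_smul]
      exact (T.map_const_smul' c (e • x)).trans (congrArg _ (hidem e x he))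
    | @add f g hd hf hg =>
      intro x
      have hc : (AEEqFun.mk _ (SimpleFunc.aestronglyMeasurable (f + g)) : L0 P 𝕜) =
          AEEqFun.mk f f.aestronglyMeasurable + AEEqFun.mk g g.aestronglyMeasurable := by
        rw [AEEqFun.mk_add_mk]
        rfl
      rw [hc, add_smul, add_smul, map_add, hf, hg]
  have hz := (AEEqFun.stronglyMeasurable ζ)
  rw [← sub_eq_zero]
  refine eq_zero_of_l0norm_eq_zero (P := P) (𝕜 := 𝕜) _
    (le_antisymm ?_ (l0norm_nonneg (P := P) (𝕜 := 𝕜) _))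
  let g : ℕ → L0 P 𝕜 := fun n => AEEqFun.mk (hz.approx n) (hz.approx n).aestronglyMeasurable
  have hbd : ∀ n, l0norm P 𝕜 (T (ζ • x) - ζ • T x) ≤
      L0.abs (ζ - g n) * (N * l0norm P 𝕜 x + l0norm P 𝕜 (T x)) := by
    intro n
    have h1 : T (ζ • x) - ζ • T x = T ((ζ - g n) • x) + -((ζ - g n) • T x) := by
      have h2 : T (g n • x) = g n • T x := hsimple _ x
      rw [sub_smul, sub_smul, map_sub, h2]
      abel
    rw [h1]
    refine (l0norm_add_le _ _).trans ?_
    rw [l0norm_neg, l0norm_smul]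
    have h3 := hN ((ζ - g n) • x)
    rw [l0norm_smul] at h3
    have h4 : L0.abs (ζ - g n) * (N * l0norm P 𝕜 x + l0norm P 𝕜 (T x)) =
        N * (L0.abs (ζ - g n) * l0norm P 𝕜 x) + L0.abs (ζ - g n) * l0norm P 𝕜 (T x) := by ring
    rw [h4]
    exact L0.add_le_add_right h3 _
  rw [L0.le_iff]
  have h1 : ∀ᵐ ω ∂P, ∀ n, l0norm P 𝕜 (T (ζ • x) - ζ • T x) ω ≤
      ‖ζ ω - hz.approx n ω‖ * (N * l0norm P 𝕜 x + l0norm P 𝕜 (T x)) ω := by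
    rw [ae_all_iff]
    intro n
    filter_upwards [(L0.le_iff _ _).1 (hbd n), L0.coeFn_mul (L0.abs (ζ - g n))
      (N * l0norm P 𝕜 x + l0norm P 𝕜 (T x)), L0.coeFn_abs (ζ - g n), L0.coeFn_sub ζ (g n),
      AEEqFun.coeFn_mk (μ := P) _ (hz.approx n).aestronglyMeasurable] with ω a1 a2 a3 a4 a5
    rw [a2, a3, a4] at a1
    have a5 : g n ω = hz.approx n ω := a5
    rwa [a5] at a1
  filter_upwards [h1, L0.coeFn_zero (P := P) (𝕜 := ℝ)] with ω b1 b2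
  rw [b2]
  have hlim : Tendsto (fun n => ‖ζ ω - hz.approx n ω‖ *
      (N * l0norm P 𝕜 x + l0norm P 𝕜 (T x)) ω) atTop (𝓝 (‖ζ ω - ζ ω‖ *
      (N * l0norm P 𝕜 x + l0norm P 𝕜 (T x)) ω)) :=
    ((tendsto_const_nhds.sub (hz.tendsto_approx ω)).norm).mul_const _
  rw [sub_self, norm_zero, zero_mul] at hlim
  exact ge_of_tendsto' hlim b1

end BoundedOperator

/-! ### `C`-semigroups, generators, `C`-resolvents -/

section Semigroup

variable {Ω : Type*} [MeasurableSpace Ω] {P : Measure Ω} [IsProbabilityMeasure P]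
  {𝕜 : Type*} [RCLike 𝕜] {S : Type*} [AddCommGroup S] [Module (L0 P 𝕜) S]
  [RandomNormedModule P 𝕜 S]

/-- `{W(s) : s ≥ 0} ⊆ B(S)` is a `C`-semigroup on `S`. -/
structure IsCSemigroup (C : BoundedOperator P 𝕜 S) (W : ℝ≥0 → BoundedOperator P 𝕜 S) : Prop where
  injective : Function.Injective C
  comp_add : ∀ (s t : ℝ≥0) (x : S), C (W (s + t) x) = W t (W s x)
  zero : W 0 = C
  strongly_continuous : ∀ x : S, @Continuous ℝ≥0 S _ (elTopology P 𝕜 S) (fun s => W s x)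

/-- `H(M, ξ)`: the `C`-semigroups with `‖W(s)‖ ≤ M e^{ξ s}` for all `s ≥ 0`. -/
def H (C : BoundedOperator P 𝕜 S) (M ξ : L0 P ℝ) : Set (ℝ≥0 → BoundedOperator P 𝕜 S) :=
  {W | IsCSemigroup C W ∧ ∀ s : ℝ≥0, (W s).opNorm ≤ M * L0.exp ((s : ℝ) • ξ)}

/-- `(W(s) x - C x) / s` tends to `y` as `s ↓ 0`, in the `(ε, λ)`-topology. -/
def HasQuotientLimit (C : BoundedOperator P 𝕜 S) (W : ℝ≥0 → BoundedOperator P 𝕜 S) (x y : S) :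
    Prop :=
  ELTendsto P 𝕜 (fun s : ℝ≥0 => L0.const P (((s : ℝ)⁻¹ : ℝ) : 𝕜) • (W s x - C x)) (𝓝[>] 0) y

theorem HasQuotientLimit.add {C : BoundedOperator P 𝕜 S} {W : ℝ≥0 → BoundedOperator P 𝕜 S}
    {x y x' y' : S} (h : HasQuotientLimit C W x y) (h' : HasQuotientLimit C W x' y') :
    HasQuotientLimit C W (x + x') (y + y') := by
  refine (ELTendsto.add h h').congr fun s => ?_
  rw [← smul_add, BoundedOperator.map_add, BoundedOperator.map_add]
  congr 1
  abel

theorem HasQuotientLimit.smul {C : BoundedOperator P 𝕜 S} {W : ℝ≥0 → BoundedOperator P 𝕜 S}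
    {x y : S} (h : HasQuotientLimit C W x y) (ζ : L0 P 𝕜) :
    HasQuotientLimit C W (ζ • x) (ζ • y) := by
  refine (ELTendsto.smul h ζ).congr fun s => ?_
  rw [BoundedOperator.map_smul, BoundedOperator.map_smul, ← smul_sub, smul_comm]

theorem HasQuotientLimit.zero (C : BoundedOperator P 𝕜 S) (W : ℝ≥0 → BoundedOperator P 𝕜 S) :
    HasQuotientLimit C W 0 0 := by
  unfold HasQuotientLimit
  simp only [BoundedOperator.map_zero, sub_zero, smul_zero]
  let _ := elTopology P 𝕜 S
  exact tendsto_const_nhds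

/-- The infinitesimal generator `(A, D(A))` of a `C`-semigroup: `D(A)` consists of the `x` for which
`lim_{s → 0} (W(s) x - C x) / s` exists and lies in the range of `C`, and
`A x = C⁻¹ lim_{s → 0} (W(s) x - C x) / s`. -/
def generator {C : BoundedOperator P 𝕜 S} {W : ℝ≥0 → BoundedOperator P 𝕜 S}
    (hW : IsCSemigroup C W) : S →ₗ.[L0 P 𝕜] S where
  domain :=
    { carrier := {x | ∃ y, HasQuotientLimit C W x (C y)}
      add_mem' := by
        rintro a b ⟨y, hy⟩ ⟨z, hz⟩
        exact ⟨y + z, by rw [BoundedOperator.map_add]; exact hy.add hz⟩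
      zero_mem' := ⟨0, by rw [BoundedOperator.map_zero]; exact HasQuotientLimit.zero C W⟩
      smul_mem' := by
        rintro ζ a ⟨y, hy⟩
        exact ⟨ζ • y, by rw [BoundedOperator.map_smul]; exact hy.smul ζ⟩ }
  toFun :=
    { toFun := fun x => Classical.choose x.2
      map_add' := by
        intro x y
        apply hW.injective
        rw [BoundedOperator.map_add]
        exact ELTendsto.unique (Classical.choose_spec (x + y).2)
          ((Classical.choose_spec x.2).add (Classical.choose_spec y.2))
      map_smul' := by
        intro ζ x
        apply hW.injective
        rw [RingHom.id_apply, BoundedOperator.map_smul]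
        exact ELTendsto.unique (Classical.choose_spec (ζ • x).2)
          ((Classical.choose_spec x.2).smul ζ) }

theorem mem_generator_domain {C : BoundedOperator P 𝕜 S} {W : ℝ≥0 → BoundedOperator P 𝕜 S}
    (hW : IsCSemigroup C W) (x : S) :
    x ∈ (generator hW).domain ↔ ∃ y, HasQuotientLimit C W x (C y) := Iff.rfl

theorem generator_spec {C : BoundedOperator P 𝕜 S} {W : ℝ≥0 → BoundedOperator P 𝕜 S}
    (hW : IsCSemigroup C W) (x : (generator hW).domain) :
    HasQuotientLimit C W x (C (generator hW x)) :=
  Classical.choose_spec x.2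

end Semigroup

section Resolvent

variable {Ω : Type*} [MeasurableSpace Ω] {P : Measure Ω} {𝕜 : Type*} [RCLike 𝕜]
  {S : Type*} [AddCommGroup S] [Module (L0 P 𝕜) S] [RandomNormedModule P 𝕜 S]

/-- The module homomorphism `η - A`, defined on `D(A)`. -/
def etaSub (η : L0 P 𝕜) (A : S →ₗ.[L0 P 𝕜] S) (x : A.domain) : S := η • (x : S) - A x

/-- The `C`-resolvent set `ρ_C(A)` of `A`: those `η ∈ L⁰(F, 𝕜)` for which `η - A` is injective and
`R(C) ⊆ R(η - A)`. -/
def cResolventSet (C : BoundedOperator P 𝕜 S) (A : S →ₗ.[L0 P 𝕜] S) : Set (L0 P 𝕜) :=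
  {η | Function.Injective (etaSub η A) ∧ Set.range C ⊆ Set.range (etaSub η A)}

/-- The `C`-resolvent `R_C(η, A) = (η - A)⁻¹ C` for `η ∈ ρ_C(A)`. -/
def cResolvent {C : BoundedOperator P 𝕜 S} {A : S →ₗ.[L0 P 𝕜] S} {η : L0 P 𝕜}
    (h : η ∈ cResolventSet C A) (x : S) : S :=
  (Classical.choose (h.2 (Set.mem_range_self x)) : A.domain)

theorem cResolvent_spec {C : BoundedOperator P 𝕜 S} {A : S →ₗ.[L0 P 𝕜] S} {η : L0 P 𝕜}
    (h : η ∈ cResolventSet C A) (x : S) :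
    ∃ hx : cResolvent h x ∈ A.domain, etaSub η A ⟨cResolvent h x, hx⟩ = C x :=
  ⟨(Classical.choose (h.2 (Set.mem_range_self x))).2,
    Classical.choose_spec (h.2 (Set.mem_range_self x))⟩

end Resolvent

/-! ### Riemann integrals and the Laplace transform -/

section Integral

variable {Ω : Type*} [MeasurableSpace Ω] (P : Measure Ω) [IsProbabilityMeasure P]
  (𝕜 : Type*) [RCLike 𝕜] {S : Type*} [AddCommGroup S] [Module (L0 P 𝕜) S]
  [RandomNormedModule P 𝕜 S]

/-- `I` is the Riemann integral of `g` over `[a, b] ⊆ [0, ∞)`: the Riemann sums over the tagged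
partitions `a = t₀ ≤ τ₀ ≤ t₁ ≤ τ₁ ≤ ⋯ ≤ tₙ = b` converge to `I` in the `(ε, λ)`-topology as the
mesh tends to zero. -/
def HasRiemannIntegral (g : ℝ≥0 → S) (a b : ℝ≥0) (I : S) : Prop :=
  ∀ V ∈ @nhds S (elTopology P 𝕜 S) I, ∃ δ : ℝ, 0 < δ ∧
    ∀ (n : ℕ) (t τ : ℕ → ℝ≥0), t 0 = a → t n = b →
      (∀ i < n, t i ≤ τ i ∧ τ i ≤ t (i + 1) ∧ (t (i + 1) : ℝ) - t i < δ) →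
      ∑ i ∈ Finset.range n, L0.const P (((t (i + 1) : ℝ) - t i : ℝ) : 𝕜) • g (τ i) ∈ V

/-- `I = ∫_0^∞ g(s) ds`: `g` is Riemann integrable on every `[0, b]` and the integrals over `[0, b]`
converge to `I` in the `(ε, λ)`-topology as `b → ∞`. -/
def HasImproperIntegral (g : ℝ≥0 → S) (I : S) : Prop :=
  ∃ J : ℝ≥0 → S, (∀ b, HasRiemannIntegral P 𝕜 g 0 b (J b)) ∧ ELTendsto P 𝕜 J atTop I

/-- `I = ∫_0^∞ e^{-η s} h(s) ds`, the Laplace transform of `h` at `η ∈ L⁰(F, ℝ)`. -/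
def HasLaplaceTransformAt (h : ℝ≥0 → S) (η : L0 P ℝ) (I : S) : Prop :=
  HasImproperIntegral P 𝕜 (fun s => L0.ofReal 𝕜 (L0.exp (-((s : ℝ) • η))) • h s) I

end Integral

end RandomModule

end

noncomputable section

namespace RandomModule

/-! ### Convergence in the `(ε, λ)`-topology through almost surely convergent subsequences. -/

section Convergence

variable {Ω : Type*} [MeasurableSpace Ω] {P : Measure Ω}
  {𝕜 : Type*} [RCLike 𝕜] {S : Type*} [AddCommGroup S] [Module (L0 P 𝕜) S]
  [RandomNormedModule P 𝕜 S]

/-! Damp the semigroup: `V(s) = e^{-η s} W(s)` satisfies `V(t) V(s) = C V(s + t)`, `V(0) = C` and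
`‖V(s) x‖ ≤ e^{-s (η - ξ)} M ‖x‖`. Since `η - ξ` is only almost surely positive, with no constant
lower bound, every estimate is made pointwise in `ω`; limits are then handled through almost surely
convergent subsequences, because `(ε, λ)`-convergence is convergence in probability of the norm.

The integrals themselves need care: `S` need not be locally convex, so continuity alone does not
give Riemann integrability. What saves the argument is a common bound `‖g(s)‖ ≤ ζ` a.s. for all `s`.
Under such a bound, closeness in the `(ε, λ)`-topology is controlled by the convex quantity `E[‖x‖ /
(1 + |ζ|)]` and controls it on differences. Riemann sums are then Cauchy as in a Banach space
(`exists_hasRiemannIntegral`), and the exponential bound makes the tails vanish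
(`exists_improper_damped`).

Let `J_b = ∫_0^b V(s) x ds` and `I = ∫_0^∞ V(s) x ds`. From `V(h) J_b = C (J_{h+b} - J_h)`, letting
`b → ∞`, comes `V(h) I - C I = -C J_h`. As `J_h / h → C x`, the difference quotient of `V` at `I`
tends to `-C C x`. Undoing the damping by the product rule gives `I ∈ D(A)` and `(η - A) I = C x`
(`etaSub_improper`), hence `R(C) ⊆ R(η - A)`.

For injectivity, suppose `A z = η z`. The quotients `T_h z = (V(h) z - C z) / h` tend to `0`. Each
`T_h` commutes with `V(s)`, so for `I` built from `x = z` one has `T_h I = ∫_0^∞ V(s) T_h z ds`, of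
norm at most `M / (η - ξ) ‖T_h z‖`, which tends to `0`. But `T_h I → -C C z`, so `C C z = 0` and `z
= 0` (`eq_zero_of_generator_eq_smul`). The resolvent value is therefore the unique preimage of `C
x`, namely `I`. -/

theorem ae_l0norm_nonneg (x : S) : ∀ᵐ ω ∂P, 0 ≤ l0norm P 𝕜 x ω := by
  filter_upwards [(L0.le_iff _ _).1 (l0norm_nonneg (P := P) (𝕜 := 𝕜) x),
    L0.coeFn_zero (P := P) (𝕜 := ℝ)] with ω h1 h2
  rwa [h2] at h1

theorem ae_l0norm_smul (ζ : L0 P 𝕜) (x : S) :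
    ∀ᵐ ω ∂P, l0norm P 𝕜 (ζ • x) ω = ‖ζ ω‖ * l0norm P 𝕜 x ω := by
  rw [l0norm_smul]
  filter_upwards [L0.coeFn_mul (L0.abs ζ) (l0norm P 𝕜 x), L0.coeFn_abs ζ] with ω h1 h2
  rw [h1, h2]

theorem ae_l0norm_add_le (x y : S) :
    ∀ᵐ ω ∂P, l0norm P 𝕜 (x + y) ω ≤ l0norm P 𝕜 x ω + l0norm P 𝕜 y ω := by
  filter_upwards [(L0.le_iff _ _).1 (l0norm_add_le (P := P) (𝕜 := 𝕜) x y),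
    L0.coeFn_add (l0norm P 𝕜 x) (l0norm P 𝕜 y)] with ω h1 h2
  rwa [h2] at h1

theorem l0norm_sub_rev (x y : S) : l0norm P 𝕜 (x - y) = l0norm P 𝕜 (y - x) := by
  rw [← neg_sub, l0norm_neg]

theorem ae_l0norm_sub_le (x y : S) :
    ∀ᵐ ω ∂P, l0norm P 𝕜 (x - y) ω ≤ l0norm P 𝕜 x ω + l0norm P 𝕜 y ω := by
  have h := ae_l0norm_add_le (P := P) (𝕜 := 𝕜) x (-y)
  rwa [l0norm_neg, ← sub_eq_add_neg] at h

theorem ae_l0norm_sum_le {ι : Type*} (s : Finset ι) (f : ι → S) :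
    ∀ᵐ ω ∂P, l0norm P 𝕜 (∑ i ∈ s, f i) ω ≤ ∑ i ∈ s, l0norm P 𝕜 (f i) ω := by
  classical
  induction s using Finset.induction_on with
  | empty =>
    filter_upwards [L0.coeFn_zero (P := P) (𝕜 := ℝ)] with ω h
    rw [Finset.sum_empty, Finset.sum_empty, l0norm_zero, h]
  | insert a s ha ih =>
    rw [Finset.sum_insert ha]
    filter_upwards [ih, ae_l0norm_add_le (P := P) (𝕜 := 𝕜) (f a) (∑ i ∈ s, f i)] with ω h1 h2
    rw [Finset.sum_insert ha]
    linarith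

theorem ae_const (c : 𝕜) : ∀ᵐ ω ∂P, L0.const P c ω = c := AEEqFun.coeFn_const Ω c

/-- The norm is only an infimum in `L⁰`, so it has to be shown to be a bound itself. The quotient
`‖T x‖ / ‖x‖`, which is `0` where `‖x‖ = 0` by the convention for division, lies below every almost
sure bound and hence below the infimum. Where `‖x‖` vanishes, any one bound already forces `‖T x‖ =
0`. -/
theorem BoundedOperator.ae_norm_le [IsProbabilityMeasure P] (T : BoundedOperator P 𝕜 S) (x : S) :
    ∀ᵐ ω ∂P, l0norm P 𝕜 (T x) ω ≤ T.opNorm ω * l0norm P 𝕜 x ω := by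
  let q : L0 P ℝ := AEEqFun.mk (fun ω => l0norm P 𝕜 (T x) ω / l0norm P 𝕜 x ω)
    ((l0norm P 𝕜 (T x)).measurable.div (l0norm P 𝕜 x).measurable).aestronglyMeasurable
  have hq : ∀ᵐ ω ∂P, q ω = l0norm P 𝕜 (T x) ω / l0norm P 𝕜 x ω := AEEqFun.coeFn_mk _ _
  have key : ∀ N ∈ T.bounds, ∀ᵐ ω ∂P, 0 ≤ N ω ∧
      l0norm P 𝕜 (T x) ω ≤ N ω * l0norm P 𝕜 x ω := by
    intro N hN
    filter_upwards [(L0.le_iff _ _).1 hN.1, (L0.le_iff _ _).1 (hN.2 x),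
      L0.coeFn_mul N (l0norm P 𝕜 x), L0.coeFn_zero (P := P) (𝕜 := ℝ)] with ω h1 h2 h3 h4
    rw [h4] at h1
    rw [h3] at h2
    exact ⟨h1, h2⟩
  have hle : q ≤ T.opNorm := by
    refine T.isGLB_opNorm.2 fun N hN => ?_
    rw [L0.le_iff]
    filter_upwards [key N hN, hq, ae_l0norm_nonneg (P := P) (𝕜 := 𝕜) x] with ω h1 h2 h3
    rw [h2]
    exact div_le_of_le_mul₀ h3 h1.1 h1.2
  obtain ⟨N, hN⟩ := T.bounded'
  filter_upwards [(L0.le_iff _ _).1 hle, hq, key N hN,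
    ae_l0norm_nonneg (P := P) (𝕜 := 𝕜) x] with ω h1 h2 h3 h4
  rcases h4.eq_or_lt with h | h
  · have h3 := h3.2
    rw [← h, mul_zero] at h3 ⊢
    exact h3
  · rw [h2, div_le_iff₀ h] at h1
    exact h1

variable [IsProbabilityMeasure P]

theorem mem_elBall_iff {ε lam : ℝ} {z : S} :
    z ∈ elBall P 𝕜 S ε lam ↔ P.real {ω | ε ≤ l0norm P 𝕜 z ω} < lam := by
  have hm : MeasurableSet {ω | l0norm P 𝕜 z ω < ε} :=
    measurableSet_lt (l0norm P 𝕜 z).measurable measurable_const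
  have h1 := probReal_compl_eq_one_sub (μ := P) hm
  have h2 : {ω | l0norm P 𝕜 z ω < ε}ᶜ = {ω | ε ≤ l0norm P 𝕜 z ω} := by
    ext ω
    simp
  rw [h2] at h1
  change 1 - lam < P.real {ω | l0norm P 𝕜 z ω < ε} ↔ _
  rw [h1]
  constructor <;> intro h <;> linarith

theorem elTendsto_iff_tendstoInMeasure {ι : Type*} {f : ι → S} {l : Filter ι} {x : S} :
    ELTendsto P 𝕜 f l x ↔
      TendstoInMeasure P (fun i => (l0norm P 𝕜 (f i - x) : Ω → ℝ)) l (fun _ => 0) := by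
  rw [elTendsto_iff, tendstoInMeasure_iff_measureReal_norm]
  have key : ∀ (ε : ℝ) (i : ι), P.real {ω | ε ≤ ‖l0norm P 𝕜 (f i - x) ω - 0‖} =
      P.real {ω | ε ≤ l0norm P 𝕜 (f i - x) ω} := by
    intro ε i
    apply measureReal_congr
    filter_upwards [ae_l0norm_nonneg (P := P) (𝕜 := 𝕜) (f i - x)] with ω h
    apply propext
    change ε ≤ ‖l0norm P 𝕜 (f i - x) ω - 0‖ ↔ ε ≤ l0norm P 𝕜 (f i - x) ω
    rw [sub_zero, Real.norm_of_nonneg h]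
  simp only [key, mem_elBall_iff]
  constructor
  · intro h ε hε
    rw [Metric.tendsto_nhds]
    intro lam hl
    -- Basic neighbourhoods require `λ < 1`, hence the cap at `1 / 2`.
    filter_upwards [h ε (min lam (1 / 2)) hε (lt_min hl (by norm_num))
      ((min_le_right _ _).trans_lt (by norm_num))] with i hi
    rw [Real.dist_eq, sub_zero, abs_of_nonneg measureReal_nonneg]
    exact hi.trans_le (min_le_left _ _)
  · intro h ε lam hε hl _
    exact (h ε hε).eventually (gt_mem_nhds hl)

theorem ELTendsto.exists_seq_ae {ι : Type*} {f : ι → S} {l : Filter ι} [l.NeBot]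
    [l.IsCountablyGenerated] {x : S} (h : ELTendsto P 𝕜 f l x) :
    ∃ ns : ℕ → ι, Tendsto ns atTop l ∧
      ∀ᵐ ω ∂P, Tendsto (fun k => l0norm P 𝕜 (f (ns k) - x) ω) atTop (𝓝 0) :=
  (elTendsto_iff_tendstoInMeasure.1 h).exists_seq_tendsto_ae'

/-- Convergence along a countably generated filter can be tested on subsequences of sequences. This
makes pointwise arguments available: only countably many indices occur, so their null sets can be
merged. -/
theorem elTendsto_of_subseq_ae {ι : Type*} {f : ι → S} {l : Filter ι}
    [l.IsCountablyGenerated] {x : S}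
    (h : ∀ ns : ℕ → ι, Tendsto ns atTop l → ∃ ms : ℕ → ℕ,
      ∀ᵐ ω ∂P, Tendsto (fun k => l0norm P 𝕜 (f (ns (ms k)) - x) ω) atTop (𝓝 0)) :
    ELTendsto P 𝕜 f l x := by
  refine tendsto_of_subseq_tendsto fun ns hns => ?_
  obtain ⟨ms, hms⟩ := h ns hns
  refine ⟨ms, ?_⟩
  exact (elTendsto_iff_tendstoInMeasure (f := fun k => f (ns (ms k)))).2
    (tendstoInMeasure_of_tendsto_ae (fun n => AEEqFun.aestronglyMeasurable _) hms)

theorem ELTendsto.comp {ι κ : Type*} {f : ι → S} {l : Filter ι} {l' : Filter κ} {x : S}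
    (h : ELTendsto P 𝕜 f l x) {u : κ → ι} (hu : Tendsto u l' l) :
    ELTendsto P 𝕜 (fun k => f (u k)) l' x :=
  Tendsto.comp h hu

theorem ELTendsto.neg {ι : Type*} {f : ι → S} {l : Filter ι} {x : S}
    (hf : ELTendsto P 𝕜 f l x) : ELTendsto P 𝕜 (fun i => -f i) l (-x) := by
  let _ := elTopology P 𝕜 S
  have := elTopology_isTopologicalAddGroup P 𝕜 S
  exact Tendsto.neg hf

theorem ELTendsto.sub {ι : Type*} {f g : ι → S} {l : Filter ι} {x y : S}
    (hf : ELTendsto P 𝕜 f l x) (hg : ELTendsto P 𝕜 g l y) :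
    ELTendsto P 𝕜 (fun i => f i - g i) l (x - y) := by
  simpa only [sub_eq_add_neg] using hf.add hg.neg

theorem elTendsto_const {ι : Type*} (l : Filter ι) (x : S) :
    ELTendsto P 𝕜 (fun _ => x) l x := by
  let _ := elTopology P 𝕜 S
  exact tendsto_const_nhds

/-- Multiplication is jointly continuous, for scalars converging almost surely along sequences. -/
theorem ELTendsto.smul_of_ae {ι : Type*} {f : ι → S} {l : Filter ι}
    [l.IsCountablyGenerated] {x : S} {ζ : ι → L0 P 𝕜} {ζ₀ : L0 P 𝕜}
    (hζ : ∀ ns : ℕ → ι, Tendsto ns atTop l →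
      ∀ᵐ ω ∂P, Tendsto (fun k => ζ (ns k) ω) atTop (𝓝 (ζ₀ ω)))
    (hf : ELTendsto P 𝕜 f l x) : ELTendsto P 𝕜 (fun i => ζ i • f i) l (ζ₀ • x) := by
  refine elTendsto_of_subseq_ae fun ns hns => ?_
  obtain ⟨ms, hms, hae⟩ := (hf.comp hns).exists_seq_ae
  refine ⟨ms, ?_⟩
  have h1 : ∀ᵐ ω ∂P, ∀ k, l0norm P 𝕜 (ζ (ns (ms k)) • f (ns (ms k)) - ζ₀ • x) ω ≤
      ‖ζ (ns (ms k)) ω‖ * l0norm P 𝕜 (f (ns (ms k)) - x) ω +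
        ‖ζ (ns (ms k)) ω - ζ₀ ω‖ * l0norm P 𝕜 x ω := by
    rw [ae_all_iff]
    intro k
    -- The usual splitting `ζ_k f_k - ζ₀ x = ζ_k (f_k - x) + (ζ_k - ζ₀) x`.
    have he : ζ (ns (ms k)) • f (ns (ms k)) - ζ₀ • x =
        ζ (ns (ms k)) • (f (ns (ms k)) - x) + (ζ (ns (ms k)) - ζ₀) • x := by
      rw [smul_sub, sub_smul]
      abel
    rw [he]
    filter_upwards [ae_l0norm_add_le (P := P) (𝕜 := 𝕜) (ζ (ns (ms k)) • (f (ns (ms k)) - x))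
      ((ζ (ns (ms k)) - ζ₀) • x), ae_l0norm_smul (P := P) (ζ (ns (ms k))) (f (ns (ms k)) - x),
      ae_l0norm_smul (P := P) (ζ (ns (ms k)) - ζ₀) x,
      L0.coeFn_sub (ζ (ns (ms k))) ζ₀] with ω a1 a2 a3 a4
    rwa [a2, a3, a4] at a1
  have h2 : ∀ᵐ ω ∂P, ∀ k, 0 ≤ l0norm P 𝕜 (ζ (ns (ms k)) • f (ns (ms k)) - ζ₀ • x) ω :=
    ae_all_iff.2 fun k => ae_l0norm_nonneg _
  filter_upwards [h1, h2, hae, hζ _ (hns.comp hms)] with ω b1 b2 b3 b4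
  have hlim : Tendsto (fun k => ‖ζ (ns (ms k)) ω‖ * l0norm P 𝕜 (f (ns (ms k)) - x) ω +
        ‖ζ (ns (ms k)) ω - ζ₀ ω‖ * l0norm P 𝕜 x ω) atTop (𝓝 (‖ζ₀ ω‖ * 0 +
        ‖ζ₀ ω - ζ₀ ω‖ * l0norm P 𝕜 x ω)) :=
    (b4.norm.mul b3).add ((b4.sub_const _).norm.mul_const _)
  rw [sub_self, norm_zero, zero_mul, mul_zero, add_zero] at hlim
  exact squeeze_zero b2 b1 hlim

/-- The factor `K` may be any finite function of `ω`, since it is fixed along the subsequence. This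
is how the unbounded random constants `‖T‖` and `M / (η - ξ)` enter. -/
theorem elTendsto_of_ae_le {ι : Type*} {f g : ι → S} {l : Filter ι}
    [l.IsCountablyGenerated] {x y : S} (K : Ω → ℝ)
    (h : ∀ i, ∀ᵐ ω ∂P, l0norm P 𝕜 (g i - y) ω ≤ K ω * l0norm P 𝕜 (f i - x) ω)
    (hf : ELTendsto P 𝕜 f l x) : ELTendsto P 𝕜 g l y := by
  refine elTendsto_of_subseq_ae fun ns hns => ?_
  obtain ⟨ms, hms, hae⟩ := (hf.comp hns).exists_seq_ae
  refine ⟨ms, ?_⟩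
  have h2 : ∀ᵐ ω ∂P, ∀ k, 0 ≤ l0norm P 𝕜 (g (ns (ms k)) - y) ω :=
    ae_all_iff.2 fun k => ae_l0norm_nonneg _
  filter_upwards [ae_all_iff.2 fun k => h (ns (ms k)), h2, hae] with ω b1 b2 b3
  have hlim := b3.const_mul (K ω)
  rw [mul_zero] at hlim
  exact squeeze_zero b2 b1 hlim

theorem elTendsto_zero_of_ae_le {ι : Type*} {g : ι → S} {l : Filter ι}
    [l.IsCountablyGenerated] (K : ι → Ω → ℝ)
    (h : ∀ i, ∀ᵐ ω ∂P, l0norm P 𝕜 (g i) ω ≤ K i ω)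
    (hK : ∀ᵐ ω ∂P, Tendsto (fun i => K i ω) l (𝓝 0)) : ELTendsto P 𝕜 g l 0 := by
  refine elTendsto_of_subseq_ae fun ns hns => ⟨id, ?_⟩
  have h2 : ∀ᵐ ω ∂P, ∀ k, 0 ≤ l0norm P 𝕜 (g (ns k)) ω :=
    ae_all_iff.2 fun k => ae_l0norm_nonneg _
  filter_upwards [ae_all_iff.2 fun k => h (ns k), h2, hK] with ω b1 b2 b3
  simp only [sub_zero]
  exact squeeze_zero b2 b1 (b3.comp hns)

theorem ELTendsto.map {ι : Type*} {f : ι → S} {l : Filter ι} [l.IsCountablyGenerated] {x : S}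
    (hf : ELTendsto P 𝕜 f l x) (T : BoundedOperator P 𝕜 S) :
    ELTendsto P 𝕜 (fun i => T (f i)) l (T x) := by
  refine elTendsto_of_ae_le T.opNorm (fun i => ?_) hf
  rw [← BoundedOperator.map_sub]
  exact T.ae_norm_le _

theorem ELTendsto.ae_norm_le {ι : Type*} {f : ι → S} {l : Filter ι} [l.NeBot]
    [l.IsCountablyGenerated] {x : S} (hf : ELTendsto P 𝕜 f l x) (B : Ω → ℝ)
    (h : ∀ᶠ i in l, ∀ᵐ ω ∂P, l0norm P 𝕜 (f i) ω ≤ B ω) : ∀ᵐ ω ∂P, l0norm P 𝕜 x ω ≤ B ω := by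
  obtain ⟨ns, hns, hae⟩ := hf.exists_seq_ae
  obtain ⟨N, hN⟩ := eventually_atTop.1 (hns.eventually h)
  have h1 : ∀ᵐ ω ∂P, ∀ k, N ≤ k → l0norm P 𝕜 x ω ≤ B ω + l0norm P 𝕜 (f (ns k) - x) ω := by
    rw [ae_all_iff]
    intro k
    by_cases hk : N ≤ k
    · filter_upwards [hN k hk, ae_l0norm_sub_le (P := P) (𝕜 := 𝕜) (f (ns k)) (f (ns k) - x)]
        with ω a1 a2 _
      rw [sub_sub_cancel] at a2
      linarith
    · exact Eventually.of_forall fun ω h => absurd h hk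
  filter_upwards [h1, hae] with ω b1 b2
  have := b2.const_add (B ω)
  rw [add_zero] at this
  exact ge_of_tendsto this (eventually_atTop.2 ⟨N, b1⟩)

end Convergence

/-! ### Constant random variables. -/

section Const

variable {Ω : Type*} [MeasurableSpace Ω] {P : Measure Ω} {𝕜 : Type*} [RCLike 𝕜]

theorem L0.const_add (c d : 𝕜) : L0.const P (c + d) = L0.const P c + L0.const P d := rfl

theorem L0.const_mul (c d : 𝕜) : L0.const P (c * d) = L0.const P c * L0.const P d := rfl

theorem L0.const_zero : L0.const P (0 : 𝕜) = 0 := rfl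

theorem L0.const_one : L0.const P (1 : 𝕜) = 1 := rfl

theorem L0.const_sum {ι : Type*} (s : Finset ι) (r : ι → ℝ) :
    L0.const P ((∑ i ∈ s, r i : ℝ) : 𝕜) = ∑ i ∈ s, L0.const P (r i : 𝕜) := by
  classical
  induction s using Finset.induction_on with
  | empty => simp [L0.const_zero]
  | insert a s ha ih =>
    rw [Finset.sum_insert ha, Finset.sum_insert ha, RCLike.ofReal_add, L0.const_add, ih]

end Const

/-! ### A convex substitute for the `(ε, λ)`-neighbourhoods. -/

section WeightedNorm

variable {Ω : Type*} [MeasurableSpace Ω] {P : Measure Ω}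
  (𝕜 : Type*) [RCLike 𝕜] {S : Type*} [AddCommGroup S] [Module (L0 P 𝕜) S]
  [RandomNormedModule P 𝕜 S]

/-- The weighted `L¹`-norm `E[‖x‖ / (1 + |ζ|)]`. -/
def weightedNorm (ζ : L0 P ℝ) (x : S) : ENNReal :=
  ∫⁻ ω, ENNReal.ofReal (l0norm P 𝕜 x ω / (1 + |ζ ω|)) ∂P

variable {𝕜}

theorem measurable_weightedNorm_integrand (ζ : L0 P ℝ) (x : S) :
    Measurable fun ω => ENNReal.ofReal (l0norm P 𝕜 x ω / (1 + |ζ ω|)) :=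
  ((l0norm P 𝕜 x).measurable.div
    (measurable_const.add (continuous_abs.measurable.comp ζ.measurable))).ennreal_ofReal

theorem weightedNorm_add_le (ζ : L0 P ℝ) (x y : S) :
    weightedNorm 𝕜 ζ (x + y) ≤ weightedNorm 𝕜 ζ x + weightedNorm 𝕜 ζ y := by
  unfold weightedNorm
  rw [← lintegral_add_left (measurable_weightedNorm_integrand ζ x)]
  refine lintegral_mono_ae ?_
  filter_upwards [ae_l0norm_add_le (P := P) (𝕜 := 𝕜) x y,
    ae_l0norm_nonneg (P := P) (𝕜 := 𝕜) x, ae_l0norm_nonneg (P := P) (𝕜 := 𝕜) y] with ω h1 h2 h3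
  rw [← ENNReal.ofReal_add (by positivity) (by positivity), ← add_div]
  gcongr

theorem weightedNorm_zero (ζ : L0 P ℝ) : weightedNorm 𝕜 ζ (0 : S) = 0 := by
  unfold weightedNorm
  rw [lintegral_eq_zero_iff (measurable_weightedNorm_integrand ζ 0)]
  filter_upwards [L0.coeFn_zero (P := P) (𝕜 := ℝ)] with ω h
  rw [l0norm_zero, h, zero_div, ENNReal.ofReal_zero, Pi.zero_apply]

theorem weightedNorm_sum_le {ι : Type*} (ζ : L0 P ℝ) (s : Finset ι) (f : ι → S) :
    weightedNorm 𝕜 ζ (∑ i ∈ s, f i) ≤ ∑ i ∈ s, weightedNorm 𝕜 ζ (f i) := by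
  classical
  induction s using Finset.induction_on with
  | empty => simp [weightedNorm_zero]
  | insert a s ha ih =>
    rw [Finset.sum_insert ha, Finset.sum_insert ha]
    exact (weightedNorm_add_le ζ _ _).trans (by gcongr)

theorem weightedNorm_const_smul (ζ : L0 P ℝ) {r : ℝ} (hr : 0 ≤ r) (x : S) :
    weightedNorm 𝕜 ζ (L0.const P (r : 𝕜) • x) = ENNReal.ofReal r * weightedNorm 𝕜 ζ x := by
  unfold weightedNorm
  rw [← lintegral_const_mul _ (measurable_weightedNorm_integrand ζ x)]
  refine lintegral_congr_ae ?_
  filter_upwards [ae_l0norm_smul (P := P) (L0.const P (r : 𝕜)) x, ae_const (P := P) (r : 𝕜)]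
    with ω h1 h2
  rw [h1, h2, RCLike.norm_ofReal, abs_of_nonneg hr, mul_div_assoc, ENNReal.ofReal_mul hr]

variable [IsProbabilityMeasure P]

/-- Where `‖z‖ < ε` the integrand is at most `ε`; elsewhere the domination by `2 |ζ|` keeps it below
`2`, on a set of probability less than `λ`. -/
theorem weightedNorm_le_of_mem_elBall {ζ : L0 P ℝ} {z : S} {ε lam : ℝ} (hε : 0 < ε)
    (hl : 0 < lam) (hz : z ∈ elBall P 𝕜 S ε lam)
    (hb : ∀ᵐ ω ∂P, l0norm P 𝕜 z ω ≤ 2 * |ζ ω|) :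
    weightedNorm 𝕜 ζ z ≤ ENNReal.ofReal (ε + 2 * lam) := by
  rw [mem_elBall_iff] at hz
  have hm : MeasurableSet {ω | ε ≤ l0norm P 𝕜 z ω} :=
    measurableSet_le measurable_const (l0norm P 𝕜 z).measurable
  calc weightedNorm 𝕜 ζ z
      ≤ ∫⁻ ω, (ENNReal.ofReal ε + {ω | ε ≤ l0norm P 𝕜 z ω}.indicator (fun _ => 2) ω) ∂P := by
        refine lintegral_mono_ae ?_
        filter_upwards [hb, ae_l0norm_nonneg (P := P) (𝕜 := 𝕜) z] with ω h1 h2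
        have h3 : 0 < 1 + |ζ ω| := by positivity
        by_cases h : ε ≤ l0norm P 𝕜 z ω
        · rw [Set.indicator_of_mem (show ω ∈ {ω | ε ≤ l0norm P 𝕜 z ω} from h)]
          refine le_trans ?_ le_add_self
          rw [← ENNReal.ofReal_ofNat 2]
          refine ENNReal.ofReal_le_ofReal ?_
          rw [div_le_iff₀ h3]
          linarith
        · rw [Set.indicator_of_notMem (show ω ∉ {ω | ε ≤ l0norm P 𝕜 z ω} from h), add_zero]
          refine ENNReal.ofReal_le_ofReal ?_
          rw [div_le_iff₀ h3]
          have := abs_nonneg (ζ ω)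
          push Not at h
          nlinarith
    _ = ENNReal.ofReal ε + 2 * P {ω | ε ≤ l0norm P 𝕜 z ω} := by
        rw [lintegral_add_left measurable_const, lintegral_const, measure_univ, mul_one,
          lintegral_indicator_const hm]
    _ ≤ ENNReal.ofReal (ε + 2 * lam) := by
        rw [ENNReal.ofReal_add hε.le (by positivity), ENNReal.ofReal_mul zero_le_two,
          ENNReal.ofReal_ofNat]
        gcongr
        rw [← ENNReal.ofReal_toReal (measure_ne_top P {ω | ε ≤ l0norm P 𝕜 z ω})]
        exact ENNReal.ofReal_le_ofReal hz.le

theorem exists_measureReal_lt_abs (ζ : L0 P ℝ) {lam : ℝ} (hl : 0 < lam) :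
    ∃ k : ℕ, P.real {ω | (k : ℝ) < |ζ ω|} < lam := by
  have hm : Measurable fun ω => |ζ ω| := continuous_abs.measurable.comp ζ.measurable
  have hanti : Antitone fun k : ℕ => {ω | (k : ℝ) < |ζ ω|} := by
    intro a b hab ω (h : (b : ℝ) < _)
    exact lt_of_le_of_lt (by exact_mod_cast hab) h
  have ht := tendsto_measure_iInter_atTop (μ := P)
    (fun k : ℕ => (measurableSet_lt (measurable_const (a := (k : ℝ))) hm).nullMeasurableSet)
    hanti ⟨0, measure_ne_top _ _⟩
  have he : (⋂ k : ℕ, {ω | (k : ℝ) < |ζ ω|}) = ∅ := by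
    ext ω
    simp only [Set.mem_iInter, Set.mem_ofPred_eq, Set.mem_empty_iff_false, iff_false, not_forall,
      not_lt]
    exact exists_nat_ge _
  rw [he, measure_empty] at ht
  have ht' := (ENNReal.tendsto_toReal ENNReal.zero_ne_top).comp ht
  exact (ht'.eventually (gt_mem_nhds (by simpa using hl))).exists

/-- Markov's inequality, after discarding a set of small probability on which the weight `1 / (1 +
|ζ|)` may degenerate. The constant depends on `ζ` but not on `z`. -/
theorem exists_weightedNorm_le_imp_mem_elBall (S : Type*) [AddCommGroup S] [Module (L0 P 𝕜) S]
    [RandomNormedModule P 𝕜 S] (ζ : L0 P ℝ) {ε lam : ℝ} (hε : 0 < ε) (hl : 0 < lam) :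
    ∃ c : ℝ, 0 < c ∧ ∀ z : S, weightedNorm 𝕜 ζ z ≤ ENNReal.ofReal c → z ∈ elBall P 𝕜 S ε lam := by
  obtain ⟨k, hk⟩ := exists_measureReal_lt_abs ζ (half_pos hl)
  have hk1 : (0 : ℝ) < 1 + k := by positivity
  -- The event `|ζ| > k` costs less than `λ / 2` and Markov's inequality costs at most `λ / 4`, so
  -- the total stays strictly below `λ`.
  refine ⟨ε / (1 + k) * (lam / 4), by positivity, fun z hz => ?_⟩
  rw [mem_elBall_iff]
  have h1 := mul_meas_ge_le_lintegral₀ (μ := P)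
    (measurable_weightedNorm_integrand (𝕜 := 𝕜) ζ z).aemeasurable (ENNReal.ofReal (ε / (1 + k)))
  have h2 : P {ω | ENNReal.ofReal (ε / (1 + k)) ≤
      ENNReal.ofReal (l0norm P 𝕜 z ω / (1 + |ζ ω|))} ≤ ENNReal.ofReal (lam / 4) := by
    have h3 := h1.trans hz
    rw [ENNReal.ofReal_mul (by positivity)] at h3
    exact (ENNReal.mul_le_mul_iff_right (ENNReal.ofReal_pos.2 (by positivity)).ne'
      ENNReal.ofReal_ne_top).1 h3
  have h3 : P.real {ω | ENNReal.ofReal (ε / (1 + k)) ≤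
      ENNReal.ofReal (l0norm P 𝕜 z ω / (1 + |ζ ω|))} ≤ lam / 4 :=
    ENNReal.toReal_le_of_le_ofReal (by positivity) h2
  have h4 : {ω | ε ≤ l0norm P 𝕜 z ω} ⊆ {ω | (k : ℝ) < |ζ ω|} ∪
      {ω | ENNReal.ofReal (ε / (1 + k)) ≤ ENNReal.ofReal (l0norm P 𝕜 z ω / (1 + |ζ ω|))} := by
    intro ω (hω : ε ≤ _)
    by_cases hb : (k : ℝ) < |ζ ω|
    · exact Or.inl hb
    · right
      push Not at hb
      refine ENNReal.ofReal_le_ofReal ?_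
      gcongr
      exact hε.le.trans hω
  have h5 := measureReal_mono (μ := P) h4
  have h6 := measureReal_union_le (μ := P) {ω | (k : ℝ) < |ζ ω|}
    {ω | ENNReal.ofReal (ε / (1 + k)) ≤ ENNReal.ofReal (l0norm P 𝕜 z ω / (1 + |ζ ω|))}
  linarith

end WeightedNorm

/-! ### Riemann sums and existence of the Riemann integral. -/

section Riemann

/-- The tagged partitions `(n, t, τ)` of `[a, b]` with mesh less than `δ`. -/
def taggedPartitions (a b : ℝ≥0) (δ : ℝ) : Set (ℕ × (ℕ → ℝ≥0) × (ℕ → ℝ≥0)) :=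
  {π | π.2.1 0 = a ∧ π.2.1 π.1 = b ∧ ∀ i < π.1, π.2.1 i ≤ π.2.2 i ∧ π.2.2 i ≤ π.2.1 (i + 1) ∧
    (π.2.1 (i + 1) : ℝ) - π.2.1 i < δ}

theorem taggedPartitions_mono (a b : ℝ≥0) {δ δ' : ℝ} (h : δ ≤ δ') :
    taggedPartitions a b δ ⊆ taggedPartitions a b δ' := fun _ hπ =>
  ⟨hπ.1, hπ.2.1, fun i hi => ⟨(hπ.2.2 i hi).1, (hπ.2.2 i hi).2.1, (hπ.2.2 i hi).2.2.trans_le h⟩⟩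

/-- The filter of tagged partitions of `[a, b]` with mesh tending to zero. -/
def meshFilter (a b : ℝ≥0) : Filter (ℕ × (ℕ → ℝ≥0) × (ℕ → ℝ≥0)) :=
  ⨅ k : ℕ, 𝓟 (taggedPartitions a b (1 / ((k : ℝ) + 1)))

instance (a b : ℝ≥0) : (meshFilter a b).IsCountablyGenerated := by
  unfold meshFilter
  infer_instance

/-- This turns the `δ`-definition of the integral into a limit along a filter; its countable
generation gives access to the subsequence criteria. -/
theorem hasBasis_meshFilter (a b : ℝ≥0) :
    (meshFilter a b).HasBasis (fun δ : ℝ => 0 < δ) (taggedPartitions a b) := by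
  have h : (meshFilter a b).HasBasis (fun _ : ℕ => True)
      fun k => taggedPartitions a b (1 / ((k : ℝ) + 1)) := by
    refine hasBasis_iInf_principal ?_
    refine directed_of_isDirected_le ?_
    intro m n hmn
    refine taggedPartitions_mono a b ?_
    gcongr
  refine h.to_hasBasis (fun k _ => ⟨1 / ((k : ℝ) + 1), by positivity, subset_rfl⟩) ?_
  intro δ hδ
  obtain ⟨k, hk⟩ := exists_nat_one_div_lt hδ
  exact ⟨k, trivial, taggedPartitions_mono a b hk.le⟩

theorem taggedPartitions_monotone {a b : ℝ≥0} {δ : ℝ} {π : ℕ × (ℕ → ℝ≥0) × (ℕ → ℝ≥0)}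
    (hπ : π ∈ taggedPartitions a b δ) {i j : ℕ} (hij : i ≤ j) (hj : j ≤ π.1) :
    π.2.1 i ≤ π.2.1 j := by
  induction j, hij using Nat.le_induction with
  | base => exact le_rfl
  | succ j hij ih =>
    have h := hπ.2.2 j hj
    exact (ih (Nat.le_of_succ_le hj)).trans (h.1.trans h.2.1)

/-- The length of `[u, v] ∩ [u', v']`. -/
def overlap (u v u' v' : ℝ) : ℝ := max 0 (min v v' - max u u')

theorem overlap_nonneg (u v u' v' : ℝ) : 0 ≤ overlap u v u' v' := le_max_left _ _

theorem overlap_comm (u v u' v' : ℝ) : overlap u v u' v' = overlap u' v' u v := by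
  unfold overlap
  rw [min_comm, max_comm u]

/-- The overlap is the increment of the clamp `t ↦ max u (min v t)` over `[u', v']`, so overlaps
with consecutive intervals telescope. -/
theorem overlap_eq_clamp {u v u' v' : ℝ} (h : u ≤ v) (h' : u' ≤ v') :
    overlap u v u' v' = max u (min v v') - max u (min v u') := by
  unfold overlap
  grind

theorem sum_overlap {u v : ℝ} (huv : u ≤ v) (n : ℕ) (t : ℕ → ℝ)
    (ht : ∀ i < n, t i ≤ t (i + 1)) (h0 : t 0 ≤ u) (hn : v ≤ t n) :
    ∑ j ∈ Finset.range n, overlap u v (t j) (t (j + 1)) = v - u := by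
  rw [Finset.sum_congr rfl fun j hj => overlap_eq_clamp huv (ht j (Finset.mem_range.1 hj)),
    Finset.sum_range_sub (fun j => max u (min v (t j))), min_eq_left hn, max_eq_right huv,
    min_eq_right (h0.trans huv), max_eq_left h0]

theorem sum_overlap_taggedPartitions {a b : ℝ≥0} {δ : ℝ}
    {π π' : ℕ × (ℕ → ℝ≥0) × (ℕ → ℝ≥0)} (hπ : π ∈ taggedPartitions a b δ)
    (hπ' : π' ∈ taggedPartitions a b δ) {i : ℕ} (hi : i < π.1) :
    ∑ j ∈ Finset.range π'.1,
      overlap (π.2.1 i) (π.2.1 (i + 1)) (π'.2.1 j) (π'.2.1 (j + 1)) =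
      (π.2.1 (i + 1) : ℝ) - π.2.1 i := by
  refine sum_overlap (t := fun j => (π'.2.1 j : ℝ)) ?_ _ ?_ ?_ ?_
  · exact_mod_cast taggedPartitions_monotone hπ (Nat.le_succ i) hi
  · intro j hj
    exact_mod_cast taggedPartitions_monotone hπ' (Nat.le_succ j) hj
  · have := taggedPartitions_monotone hπ (Nat.zero_le i) hi.le
    rw [hπ.1, ← hπ'.1] at this
    exact_mod_cast this
  · have := taggedPartitions_monotone hπ (Nat.succ_le_of_lt hi) le_rfl
    rw [hπ.2.1, ← hπ'.2.1] at this
    exact_mod_cast this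

variable {Ω : Type*} [MeasurableSpace Ω] (P : Measure Ω)
  (𝕜 : Type*) [RCLike 𝕜] {S : Type*} [AddCommGroup S] [Module (L0 P 𝕜) S]

/-- The Riemann sum of `g` over a tagged partition. -/
def riemannSum (g : ℝ≥0 → S) (π : ℕ × (ℕ → ℝ≥0) × (ℕ → ℝ≥0)) : S :=
  ∑ i ∈ Finset.range π.1,
    L0.const P (((π.2.1 (i + 1) : ℝ) - π.2.1 i : ℝ) : 𝕜) • g (π.2.2 i)

variable {P 𝕜}

/-- Overlap lengths do the work of a common refinement: each interval of one partition has as length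
the sum of its overlaps with those of the other. -/
theorem riemannSum_sub_eq {g : ℝ≥0 → S} {a b : ℝ≥0} {δ : ℝ}
    {π π' : ℕ × (ℕ → ℝ≥0) × (ℕ → ℝ≥0)} (hπ : π ∈ taggedPartitions a b δ)
    (hπ' : π' ∈ taggedPartitions a b δ) :
    riemannSum P 𝕜 g π - riemannSum P 𝕜 g π' =
      ∑ i ∈ Finset.range π.1, ∑ j ∈ Finset.range π'.1,
        L0.const P ((overlap (π.2.1 i) (π.2.1 (i + 1)) (π'.2.1 j) (π'.2.1 (j + 1)) : ℝ) : 𝕜) •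
          (g (π.2.2 i) - g (π'.2.2 j)) := by
  have key : ∀ {π π' : ℕ × (ℕ → ℝ≥0) × (ℕ → ℝ≥0)}, π ∈ taggedPartitions a b δ →
      π' ∈ taggedPartitions a b δ → riemannSum P 𝕜 g π =
      ∑ i ∈ Finset.range π.1, ∑ j ∈ Finset.range π'.1,
        L0.const P ((overlap (π.2.1 i) (π.2.1 (i + 1)) (π'.2.1 j) (π'.2.1 (j + 1)) : ℝ) : 𝕜) •
          g (π.2.2 i) := by
    intro π π' hπ hπ'
    refine Finset.sum_congr rfl fun i hi => ?_
    rw [← Finset.sum_smul, ← L0.const_sum,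
      sum_overlap_taggedPartitions hπ hπ' (Finset.mem_range.1 hi)]
  rw [key hπ hπ', key hπ' hπ, Finset.sum_comm (s := Finset.range π'.1)]
  simp only [smul_sub, Finset.sum_sub_distrib]
  congr 1
  refine Finset.sum_congr rfl fun i _ => Finset.sum_congr rfl fun j _ => ?_
  rw [overlap_comm]

variable [RandomNormedModule P 𝕜 S]

theorem weightedNorm_riemannSum_sub_le {g : ℝ≥0 → S} {a b : ℝ≥0} {δ : ℝ} {ζ : L0 P ℝ}
    {c : ENNReal} (hg : ∀ s ∈ Set.Icc a b, ∀ t ∈ Set.Icc a b, dist s t < 2 * δ →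
      weightedNorm 𝕜 ζ (g s - g t) ≤ c)
    {π π' : ℕ × (ℕ → ℝ≥0) × (ℕ → ℝ≥0)} (hπ : π ∈ taggedPartitions a b δ)
    (hπ' : π' ∈ taggedPartitions a b δ) :
    weightedNorm 𝕜 ζ (riemannSum P 𝕜 g π - riemannSum P 𝕜 g π') ≤
      ENNReal.ofReal (b - a) * c := by
  have htag : ∀ {π : ℕ × (ℕ → ℝ≥0) × (ℕ → ℝ≥0)}, π ∈ taggedPartitions a b δ → ∀ i < π.1,
      π.2.2 i ∈ Set.Icc a b := by
    intro π hπ i hi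
    have h := hπ.2.2 i hi
    have h1 := taggedPartitions_monotone hπ (Nat.zero_le i) hi.le
    have h2 := taggedPartitions_monotone hπ (Nat.succ_le_of_lt hi) le_rfl
    rw [hπ.1] at h1
    rw [hπ.2.1] at h2
    exact ⟨h1.trans h.1, h.2.1.trans h2⟩
  rw [riemannSum_sub_eq hπ hπ']
  have hterm : ∀ i ∈ Finset.range π.1, ∀ j ∈ Finset.range π'.1,
      weightedNorm 𝕜 ζ (L0.const P ((overlap (π.2.1 i) (π.2.1 (i + 1)) (π'.2.1 j)
        (π'.2.1 (j + 1)) : ℝ) : 𝕜) • (g (π.2.2 i) - g (π'.2.2 j))) ≤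
      ENNReal.ofReal (overlap (π.2.1 i) (π.2.1 (i + 1)) (π'.2.1 j) (π'.2.1 (j + 1))) * c := by
    intro i hi j hj
    rw [Finset.mem_range] at hi hj
    rw [weightedNorm_const_smul ζ (overlap_nonneg _ _ _ _)]
    -- Pairs of intervals that do not overlap carry weight zero. If they overlap, both have length
    -- less than `δ`, so their tags are less than `2 δ` apart.
    by_cases h0 : overlap (π.2.1 i) (π.2.1 (i + 1)) (π'.2.1 j) (π'.2.1 (j + 1)) = 0
    · rw [h0]
      simp
    · gcongr
      refine hg _ (htag hπ i hi) _ (htag hπ' j hj) ?_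
      have h1 := hπ.2.2 i hi
      have h2 := hπ'.2.2 j hj
      have h3 : max (π.2.1 i : ℝ) (π'.2.1 j) < min (π.2.1 (i + 1) : ℝ) (π'.2.1 (j + 1)) := by
        by_contra hle
        exact h0 (max_eq_left (by push Not at hle; linarith))
      rw [max_lt_iff, lt_min_iff, lt_min_iff] at h3
      have e1 : (π.2.1 i : ℝ) ≤ π.2.2 i := h1.1
      have e2 : (π.2.2 i : ℝ) ≤ π.2.1 (i + 1) := h1.2.1
      have e3 : (π'.2.1 j : ℝ) ≤ π'.2.2 j := h2.1
      have e4 : (π'.2.2 j : ℝ) ≤ π'.2.1 (j + 1) := h2.2.1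
      rw [NNReal.dist_eq, abs_lt]
      constructor <;> linarith [h1.2.2, h2.2.2]
  have hsum : ∑ i ∈ Finset.range π.1, ∑ j ∈ Finset.range π'.1,
      overlap (π.2.1 i) (π.2.1 (i + 1)) (π'.2.1 j) (π'.2.1 (j + 1)) = (b : ℝ) - a := by
    rw [Finset.sum_congr rfl fun i hi =>
        sum_overlap_taggedPartitions hπ hπ' (Finset.mem_range.1 hi),
      Finset.sum_range_sub (fun i => (π.2.1 i : ℝ)), hπ.1, hπ.2.1]
  calc _ ≤ ∑ i ∈ Finset.range π.1, ∑ j ∈ Finset.range π'.1,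
        ENNReal.ofReal (overlap (π.2.1 i) (π.2.1 (i + 1)) (π'.2.1 j) (π'.2.1 (j + 1))) * c := by
        refine (weightedNorm_sum_le ζ _ _).trans (Finset.sum_le_sum fun i hi => ?_)
        exact (weightedNorm_sum_le ζ _ _).trans (Finset.sum_le_sum fun j hj => hterm i hi j hj)
    _ = ENNReal.ofReal (b - a) * c := by
        rw [← hsum, ENNReal.ofReal_sum_of_nonneg
          fun i _ => Finset.sum_nonneg fun j _ => overlap_nonneg _ _ _ _, Finset.sum_mul]
        refine Finset.sum_congr rfl fun i _ => ?_
        rw [ENNReal.ofReal_sum_of_nonneg fun j _ => overlap_nonneg _ _ _ _, Finset.sum_mul]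

variable [IsProbabilityMeasure P]

theorem hasRiemannIntegral_iff {g : ℝ≥0 → S} {a b : ℝ≥0} {I : S} :
    HasRiemannIntegral P 𝕜 g a b I ↔
      ELTendsto P 𝕜 (riemannSum P 𝕜 g) (meshFilter a b) I := by
  unfold ELTendsto
  rw [(hasBasis_meshFilter a b).tendsto_left_iff]
  unfold HasRiemannIntegral
  refine forall₂_congr fun V _ => exists_congr fun δ => and_congr_right fun _ => ?_
  constructor
  · rintro h ⟨n, t, τ⟩ ⟨h0, hn, ht⟩
    exact h n t τ h0 hn ht
  · intro h n t τ h0 hn ht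
    exact h (x := ⟨n, t, τ⟩) ⟨h0, hn, ht⟩

variable (P 𝕜 S) in
theorem elUniformity_eq_comap :
    @uniformity S (elUniformSpace P 𝕜 S) =
      comap (fun q : S × S => q.2 - q.1) (@nhds S (elTopology P 𝕜 S) 0) := by
  simp only [sub_eq_add_neg]
  rfl

/-- The Heine–Cantor theorem on the compact interval, read in the uniformity of differences. -/
theorem exists_dist_lt_imp_sub_mem_elBall {g : ℝ≥0 → S}
    (hg : @Continuous ℝ≥0 S _ (elTopology P 𝕜 S) g) (a b : ℝ≥0) {ε lam : ℝ} (hε : 0 < ε)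
    (hl : 0 < lam) (hl1 : lam < 1) :
    ∃ δ : ℝ, 0 < δ ∧ ∀ s ∈ Set.Icc a b, ∀ t ∈ Set.Icc a b, dist s t < δ →
      g s - g t ∈ elBall P 𝕜 S ε lam := by
  let _ := elUniformSpace P 𝕜 S
  have := elTopology_isTopologicalAddGroup P 𝕜 S
  have hu : UniformContinuousOn g (Set.Icc a b) :=
    isCompact_Icc.uniformContinuousOn_of_continuous hg.continuousOn
  have hV : {q : S × S | q.2 - q.1 ∈ elBall P 𝕜 S ε lam} ∈ uniformity S := by
    rw [elUniformity_eq_comap]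
    exact preimage_mem_comap ((elBasis P 𝕜 S).mem_nhds_zero ⟨ε, lam, hε, hl, hl1, rfl⟩)
  have h := hu hV
  rw [mem_map, (Metric.uniformity_basis_dist.inf_principal _).mem_iff] at h
  obtain ⟨δ, hδ, hsub⟩ := h
  refine ⟨δ, hδ, fun s hs t ht hst => ?_⟩
  exact hsub (a := (t, s)) ⟨by rwa [Set.mem_ofPred_eq, dist_comm], ht, hs⟩

theorem exists_dist_lt_imp_weightedNorm_le {g : ℝ≥0 → S} {ζ : L0 P ℝ}
    (hg : @Continuous ℝ≥0 S _ (elTopology P 𝕜 S) g)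
    (hζ : ∀ s, ∀ᵐ ω ∂P, l0norm P 𝕜 (g s) ω ≤ ζ ω) (a b : ℝ≥0) {c : ℝ} (hc : 0 < c) :
    ∃ δ : ℝ, 0 < δ ∧ ∀ s ∈ Set.Icc a b, ∀ t ∈ Set.Icc a b, dist s t < δ →
      weightedNorm 𝕜 ζ (g s - g t) ≤ ENNReal.ofReal c := by
  -- With `ε = c / 2` and `λ ≤ c / 4`, the bound `ε + 2 λ` is at most `c`.
  obtain ⟨δ, hδ, h⟩ := exists_dist_lt_imp_sub_mem_elBall hg a b (half_pos hc)
    (lam := min (c / 4) (1 / 2)) (by positivity) ((min_le_right _ _).trans_lt (by norm_num))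
  refine ⟨δ, hδ, fun s hs t ht hst => ?_⟩
  refine (weightedNorm_le_of_mem_elBall (half_pos hc) (by positivity) (h s hs t ht hst) ?_).trans
    (ENNReal.ofReal_le_ofReal ?_)
  · filter_upwards [hζ s, hζ t, ae_l0norm_sub_le (P := P) (𝕜 := 𝕜) (g s) (g t)] with ω h1 h2 h3
    linarith [le_abs_self (ζ ω)]
  · linarith [min_le_left (c / 4) (1 / 2)]

/-- The partition of `[a, a + c]` into `N + 1` intervals of the same length, tagged by the right
endpoints. -/
def uniformPartition (a c : ℝ≥0) (N : ℕ) : ℕ × (ℕ → ℝ≥0) × (ℕ → ℝ≥0) :=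
  (N + 1, fun i => a + i * (c / (N + 1)), fun i => a + (i + 1 : ℕ) * (c / (N + 1)))

theorem tendsto_uniformPartition (a c : ℝ≥0) :
    Tendsto (uniformPartition a c) atTop (meshFilter a (a + c)) := by
  rw [(hasBasis_meshFilter a (a + c)).tendsto_right_iff]
  intro δ hδ
  have h : Tendsto (fun N : ℕ => (c : ℝ) * (1 / ((N : ℝ) + 1))) atTop (𝓝 (c * 0)) :=
    tendsto_one_div_add_atTop_nhds_zero_nat.const_mul _
  rw [mul_zero] at h
  filter_upwards [h.eventually (gt_mem_nhds hδ)] with N hN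
  refine ⟨by simp [uniformPartition], ?_, fun i _ => ⟨?_, le_rfl, ?_⟩⟩
  · have : (N : ℝ≥0) + 1 ≠ 0 := by positivity
    simp only [uniformPartition]
    push_cast
    field_simp
  · simp only [uniformPartition]
    gcongr
    exact Nat.le_succ i
  · simp only [uniformPartition]
    push_cast
    refine lt_of_eq_of_lt ?_ hN
    ring

/-- Writing the right endpoint as `a + c` guarantees that partitions exist; for an endpoint below
`a` there are none. -/
instance (a c : ℝ≥0) : (meshFilter a (a + c)).NeBot := (tendsto_uniformPartition a c).neBot

/-- Two Riemann sums of fine mesh differ, in weighted norm, by at most the length of the interval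
times the oscillation of `g`. They are thus Cauchy in the `(ε, λ)`-uniformity, and completeness
gives the limit. -/
theorem exists_hasRiemannIntegral (hS : IsELComplete P 𝕜 S) {g : ℝ≥0 → S} {ζ : L0 P ℝ}
    (hg : @Continuous ℝ≥0 S _ (elTopology P 𝕜 S) g)
    (hζ : ∀ s, ∀ᵐ ω ∂P, l0norm P 𝕜 (g s) ω ≤ ζ ω) (a c : ℝ≥0) :
    ∃ J, HasRiemannIntegral P 𝕜 g a (a + c) J := by
  simp only [hasRiemannIntegral_iff]
  let _ := elUniformSpace P 𝕜 S
  have := elTopology_isTopologicalAddGroup P 𝕜 S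
  have : CompleteSpace S := hS
  have hC : Cauchy (map (riemannSum P 𝕜 g) (meshFilter a (a + c))) := by
    rw [cauchy_map_iff]
    refine ⟨inferInstance, ?_⟩
    rw [elUniformity_eq_comap, tendsto_comap_iff,
      (elBasis P 𝕜 S).nhds_zero_hasBasis.tendsto_right_iff]
    rintro _ ⟨ε, lam, hε, hl, hl1, rfl⟩
    obtain ⟨d, hd, h⟩ := exists_weightedNorm_le_imp_mem_elBall (𝕜 := 𝕜) S ζ hε hl
    -- Oscillation `d / (c + 1)` on an interval of length `c` contributes at most `d`; the `+ 1`
    -- covers `c = 0`. The mesh is halved below because tags may be two meshes apart.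
    obtain ⟨δ, hδ, hδg⟩ := exists_dist_lt_imp_weightedNorm_le hg hζ a (a + c)
      (c := d / (c + 1)) (by positivity)
    have hδ2 : 2 * (δ / 2) = δ := by ring
    have hmem := (hasBasis_meshFilter a (a + c)).mem_of_mem (half_pos hδ)
    filter_upwards [prod_mem_prod hmem hmem] with q hq
    refine h _ ((weightedNorm_riemannSum_sub_le (by rwa [hδ2]) hq.2 hq.1).trans ?_)
    rw [← ENNReal.ofReal_mul (by simp)]
    refine ENNReal.ofReal_le_ofReal ?_
    push_cast
    rw [add_sub_cancel_left, mul_div_assoc', div_le_iff₀ (by positivity)]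
    nlinarith [c.coe_nonneg]
  obtain ⟨J, hJ⟩ := CompleteSpace.complete hC
  exact ⟨J, hJ⟩

end Riemann

/-! ### Additivity of the integral and its commutation with operators. -/

section Additivity

/-- The concatenation of two tagged partitions. -/
def concatPartition (π π' : ℕ × (ℕ → ℝ≥0) × (ℕ → ℝ≥0)) : ℕ × (ℕ → ℝ≥0) × (ℕ → ℝ≥0) :=
  (π.1 + π'.1, fun i => if i ≤ π.1 then π.2.1 i else π'.2.1 (i - π.1),
    fun i => if i < π.1 then π.2.2 i else π'.2.2 (i - π.1))

theorem concatPartition_node_add {a b c : ℝ≥0} {δ δ' : ℝ}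
    {π π' : ℕ × (ℕ → ℝ≥0) × (ℕ → ℝ≥0)}
    (hπ : π ∈ taggedPartitions a b δ) (hπ' : π' ∈ taggedPartitions b c δ') (j : ℕ) :
    (concatPartition π π').2.1 (π.1 + j) = π'.2.1 j := by
  -- At `j = 0` the definition picks the last node of `π`, which is `b`, the first node of `π'`.
  rcases Nat.eq_zero_or_pos j with rfl | hj
  · simp [concatPartition, hπ.2.1, hπ'.1]
  · simp [concatPartition, hj.ne']

theorem concatPartition_mem {a b c : ℝ≥0} {δ : ℝ} {π π' : ℕ × (ℕ → ℝ≥0) × (ℕ → ℝ≥0)}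
    (hπ : π ∈ taggedPartitions a b δ) (hπ' : π' ∈ taggedPartitions b c δ) :
    concatPartition π π' ∈ taggedPartitions a c δ := by
  refine ⟨by simp [concatPartition, hπ.1], ?_, fun i hi => ?_⟩
  · exact (concatPartition_node_add hπ hπ' _).trans hπ'.2.1
  · have hi : i < π.1 + π'.1 := hi
    rcases lt_or_ge i π.1 with h | h
    · have h' : i + 1 ≤ π.1 := h
      simpa only [concatPartition, h, h.le, h', if_true] using hπ.2.2 i h
    · obtain ⟨j, rfl⟩ := Nat.exists_eq_add_of_le h
      have hτ : (concatPartition π π').2.2 (π.1 + j) = π'.2.2 j := by simp [concatPartition]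
      rw [add_assoc, concatPartition_node_add hπ hπ', concatPartition_node_add hπ hπ', hτ]
      exact hπ'.2.2 j (by omega)

variable {Ω : Type*} [MeasurableSpace Ω] {P : Measure Ω}
  {𝕜 : Type*} [RCLike 𝕜] {S : Type*} [AddCommGroup S] [Module (L0 P 𝕜) S]

theorem riemannSum_concatPartition {a b c : ℝ≥0} {δ δ' : ℝ}
    {π π' : ℕ × (ℕ → ℝ≥0) × (ℕ → ℝ≥0)} (hπ : π ∈ taggedPartitions a b δ)
    (hπ' : π' ∈ taggedPartitions b c δ') (g : ℝ≥0 → S) :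
    riemannSum P 𝕜 g (concatPartition π π') = riemannSum P 𝕜 g π + riemannSum P 𝕜 g π' := by
  unfold riemannSum
  rw [show (concatPartition π π').1 = π.1 + π'.1 from rfl, Finset.sum_range_add]
  congr 1
  · refine Finset.sum_congr rfl fun i hi => ?_
    have h := Finset.mem_range.1 hi
    have h' : i + 1 ≤ π.1 := h
    simp only [concatPartition, h, h.le, h', if_true]
  · refine Finset.sum_congr rfl fun j _ => ?_
    have hτ : (concatPartition π π').2.2 (π.1 + j) = π'.2.2 j := by simp [concatPartition]
    rw [add_assoc, concatPartition_node_add hπ hπ', concatPartition_node_add hπ hπ', hτ]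

theorem riemannSum_uniformPartition (g : ℝ≥0 → S) (a c : ℝ≥0) (N : ℕ) :
    riemannSum P 𝕜 g (uniformPartition a c N) = ∑ i ∈ Finset.range (N + 1),
      L0.const P (((c : ℝ) / ((N : ℝ) + 1) : ℝ) : 𝕜) • g (a + (i + 1 : ℕ) * (c / (N + 1))) := by
  refine Finset.sum_congr rfl fun i _ => ?_
  have : ((uniformPartition a c N).2.1 (i + 1) : ℝ) - (uniformPartition a c N).2.1 i =
      (c : ℝ) / ((N : ℝ) + 1) := by
    simp only [uniformPartition]
    push_cast
    ring
  rw [this]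
  rfl

variable [RandomNormedModule P 𝕜 S]

theorem BoundedOperator.map_riemannSum (T : BoundedOperator P 𝕜 S) (g : ℝ≥0 → S)
    (π : ℕ × (ℕ → ℝ≥0) × (ℕ → ℝ≥0)) :
    T (riemannSum P 𝕜 g π) = riemannSum P 𝕜 (fun s => T (g s)) π := by
  unfold riemannSum
  refine (map_sum T.toAddMonoidHom _ _).trans (Finset.sum_congr rfl fun i _ => ?_)
  exact T.map_smul _ _

variable [IsProbabilityMeasure P]

theorem HasRiemannIntegral.tendsto_uniform {g : ℝ≥0 → S} {a c : ℝ≥0} {J : S}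
    (h : HasRiemannIntegral P 𝕜 g a (a + c) J) :
    ELTendsto P 𝕜 (fun N => riemannSum P 𝕜 g (uniformPartition a c N)) atTop J :=
  (hasRiemannIntegral_iff.1 h).comp (tendsto_uniformPartition a c)

theorem HasRiemannIntegral.map {g : ℝ≥0 → S} {a b : ℝ≥0} {J : S}
    (h : HasRiemannIntegral P 𝕜 g a b J) (T : BoundedOperator P 𝕜 S) :
    HasRiemannIntegral P 𝕜 (fun s => T (g s)) a b (T J) := by
  rw [hasRiemannIntegral_iff] at h ⊢
  exact (h.map T).congr fun π => T.map_riemannSum g π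

/-- Concatenated uniform partitions have mesh tending to zero, and their Riemann sums split exactly.
-/
theorem HasRiemannIntegral.unique_add {g : ℝ≥0 → S} {a c d : ℝ≥0} {J J₁ J₂ : S}
    (h : HasRiemannIntegral P 𝕜 g a (a + c + d) J)
    (h₁ : HasRiemannIntegral P 𝕜 g a (a + c) J₁)
    (h₂ : HasRiemannIntegral P 𝕜 g (a + c) (a + c + d) J₂) : J = J₁ + J₂ := by
  have hmem : ∀ δ : ℝ, 0 < δ → ∀ᶠ N in atTop,
      uniformPartition a c N ∈ taggedPartitions a (a + c) δ ∧
      uniformPartition (a + c) d N ∈ taggedPartitions (a + c) (a + c + d) δ := fun δ hδ =>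
    ((hasBasis_meshFilter _ _).tendsto_right_iff.1 (tendsto_uniformPartition a c) δ hδ).and
      ((hasBasis_meshFilter _ _).tendsto_right_iff.1 (tendsto_uniformPartition (a + c) d) δ hδ)
  have ht : Tendsto (fun N => concatPartition (uniformPartition a c N)
      (uniformPartition (a + c) d N)) atTop (meshFilter a (a + c + d)) := by
    rw [(hasBasis_meshFilter _ _).tendsto_right_iff]
    intro δ hδ
    filter_upwards [hmem δ hδ] with N hN using concatPartition_mem hN.1 hN.2
  refine ((hasRiemannIntegral_iff.1 h).comp ht).unique
    ((h₁.tendsto_uniform.add h₂.tendsto_uniform).congr' ?_)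
  filter_upwards [hmem 1 one_pos] with N hN
  exact (riemannSum_concatPartition hN.1 hN.2 g).symm

end Additivity

/-! ### Exponential bounds and averages over short intervals. -/

section Estimates

/-- Right-endpoint sums of a decreasing exponential lie below its integral. Termwise this is `h d +
1 ≤ e^{h d}`, after which the sum telescopes. -/
theorem sum_mul_exp_le {h d : ℝ} (hd : 0 < d) (n : ℕ) :
    ∑ i ∈ Finset.range n, h * Real.exp (-(((i : ℝ) + 1) * h * d)) ≤ 1 / d := by
  rw [le_div_iff₀ hd, Finset.sum_mul]
  calc ∑ i ∈ Finset.range n, h * Real.exp (-(((i : ℝ) + 1) * h * d)) * d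
      ≤ ∑ i ∈ Finset.range n,
        (-Real.exp (-(((i + 1 : ℕ) : ℝ) * h * d)) - -Real.exp (-((i : ℝ) * h * d))) := by
        refine Finset.sum_le_sum fun i _ => ?_
        have h1 : Real.exp (-((i : ℝ) * h * d)) =
            Real.exp (-(((i : ℝ) + 1) * h * d)) * Real.exp (h * d) := by
          rw [← Real.exp_add]
          congr 1
          ring
        have h2 := Real.add_one_le_exp (h * d)
        have h3 := (Real.exp_pos (-(((i : ℝ) + 1) * h * d))).le
        push_cast
        rw [h1]
        nlinarith
    _ ≤ 1 := by
        rw [Finset.sum_range_sub (fun i : ℕ => -Real.exp (-((i : ℝ) * h * d)))]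
        have := Real.exp_pos (-((n : ℝ) * h * d))
        simp
        linarith

variable {Ω : Type*} [MeasurableSpace Ω] {P : Measure Ω} [IsProbabilityMeasure P]
  {𝕜 : Type*} [RCLike 𝕜] {S : Type*} [AddCommGroup S] [Module (L0 P 𝕜) S]
  [RandomNormedModule P 𝕜 S]

/-- The bound does not depend on the length `c`: it serves both for the tails, through the factor
`e^{-a d}`, and for the whole half-line, with `a = 0`. It is proved on uniform sums and passes to
the limit. -/
theorem HasRiemannIntegral.ae_norm_le_exp {g : ℝ≥0 → S} {a c : ℝ≥0} {J : S}
    (hJ : HasRiemannIntegral P 𝕜 g a (a + c) J) {d K : Ω → ℝ} (hd : ∀ᵐ ω ∂P, 0 < d ω)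
    (hK : ∀ᵐ ω ∂P, 0 ≤ K ω)
    (hg : ∀ s : ℝ≥0, ∀ᵐ ω ∂P, l0norm P 𝕜 (g s) ω ≤ Real.exp (-(s * d ω)) * K ω) :
    ∀ᵐ ω ∂P, l0norm P 𝕜 J ω ≤ Real.exp (-(a * d ω)) * (K ω / d ω) := by
  refine hJ.tendsto_uniform.ae_norm_le _ (Eventually.of_forall fun N => ?_)
  rw [riemannSum_uniformPartition]
  have hterm : ∀ᵐ ω ∂P, ∀ i : ℕ, l0norm P 𝕜 (L0.const P (((c : ℝ) / ((N : ℝ) + 1) : ℝ) : 𝕜) •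
      g (a + (i + 1 : ℕ) * (c / (N + 1)))) ω ≤ Real.exp (-(a * d ω)) * K ω *
      ((c : ℝ) / ((N : ℝ) + 1) *
        Real.exp (-(((i : ℝ) + 1) * ((c : ℝ) / ((N : ℝ) + 1)) * d ω))) := by
    rw [ae_all_iff]
    intro i
    have hpos : 0 ≤ (c : ℝ) / ((N : ℝ) + 1) := by positivity
    filter_upwards [ae_l0norm_smul (P := P) (L0.const P (((c : ℝ) / ((N : ℝ) + 1) : ℝ) : 𝕜))
        (g (a + (i + 1 : ℕ) * (c / (N + 1)))),
      ae_const (P := P) (((c : ℝ) / ((N : ℝ) + 1) : ℝ) : 𝕜),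
      hg (a + (i + 1 : ℕ) * (c / (N + 1)))] with ω h1 h2 h3
    rw [h1, h2, RCLike.norm_ofReal, abs_of_nonneg hpos]
    refine (mul_le_mul_of_nonneg_left h3 hpos).trans (le_of_eq ?_)
    have : Real.exp (-(((a + (i + 1 : ℕ) * (c / (N + 1)) : ℝ≥0) : ℝ) * d ω)) =
        Real.exp (-(a * d ω)) * Real.exp (-(((i : ℝ) + 1) * ((c : ℝ) / ((N : ℝ) + 1)) * d ω)) := by
      rw [← Real.exp_add]
      congr 1
      push_cast
      ring
    rw [this]
    ring
  filter_upwards [hterm, hd, hK, ae_l0norm_sum_le (P := P) (𝕜 := 𝕜) (Finset.range (N + 1))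
    (fun i => L0.const P (((c : ℝ) / ((N : ℝ) + 1) : ℝ) : 𝕜) •
      g (a + (i + 1 : ℕ) * (c / (N + 1))))] with ω h1 h2 h3 h4
  refine h4.trans ((Finset.sum_le_sum fun i _ => h1 i).trans ?_)
  rw [← Finset.mul_sum]
  have h5 := sum_mul_exp_le (h := (c : ℝ) / ((N : ℝ) + 1)) h2 (N + 1)
  refine (mul_le_mul_of_nonneg_left h5 (by positivity)).trans (le_of_eq ?_)
  ring

theorem sub_mem_elBall_comm {ε lam : ℝ} {x y : S} (h : x - y ∈ elBall P 𝕜 S ε lam) :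
    y - x ∈ elBall P 𝕜 S ε lam := by
  rw [mem_elBall_iff, l0norm_sub_rev] at h
  rwa [mem_elBall_iff]

/-- The averages of a bounded continuous curve over `[0, h]` converge to its value at `0`. -/
theorem elTendsto_average {g : ℝ≥0 → S} {ζ : L0 P ℝ}
    (hg : @Continuous ℝ≥0 S _ (elTopology P 𝕜 S) g)
    (hζ : ∀ s, ∀ᵐ ω ∂P, l0norm P 𝕜 (g s) ω ≤ ζ ω) {J : ℝ≥0 → S}
    (hJ : ∀ h, HasRiemannIntegral P 𝕜 g 0 h (J h)) :
    ELTendsto P 𝕜 (fun h : ℝ≥0 => L0.const P (((h : ℝ)⁻¹ : ℝ) : 𝕜) • J h) (𝓝[>] 0) (g 0) := by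
  rw [elTendsto_iff]
  intro ε lam hε hl hl1
  obtain ⟨d, hd, hball⟩ := exists_weightedNorm_le_imp_mem_elBall (𝕜 := 𝕜) S ζ (half_pos hε)
    (half_pos hl)
  obtain ⟨δ, hδ, hδg⟩ := exists_dist_lt_imp_weightedNorm_le hg hζ 0 1 hd
  have hsmall : ∀ᶠ h : ℝ≥0 in 𝓝[>] 0, h < min 1 (Real.toNNReal δ) :=
    nhdsWithin_le_nhds (gt_mem_nhds (lt_min one_pos (Real.toNNReal_pos.2 hδ)))
  filter_upwards [hsmall, self_mem_nhdsWithin] with h hh (hpos : 0 < h)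
  have hpos' : (0 : ℝ) < h := hpos
  obtain ⟨hh1, hh2⟩ := lt_min_iff.1 hh
  have hh2 : (h : ℝ) < δ := by
    rwa [Real.lt_toNNReal_iff_coe_lt] at hh2
  have hJ' : HasRiemannIntegral P 𝕜 g 0 (0 + h) (J h) := by
    rw [zero_add]
    exact hJ h
  obtain ⟨N, hN⟩ := ((elTendsto_iff P 𝕜 _ _ _).1
    (hJ'.tendsto_uniform.smul (L0.const P (((h : ℝ)⁻¹ : ℝ) : 𝕜))) (ε / 2) (lam / 2)
    (by linarith) (by linarith) (by linarith)).exists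
  have hone : ∑ i ∈ Finset.range (N + 1), (1 / ((N : ℝ) + 1)) = 1 := by
    rw [Finset.sum_const, Finset.card_range, nsmul_eq_mul]
    push_cast
    field_simp
  -- The averaged sum minus `g 0` is a convex combination of the increments `g(τ_i) - g(0)`, each
  -- small in weighted norm since `τ_i ≤ h < δ`.
  have hdiff : L0.const P (((h : ℝ)⁻¹ : ℝ) : 𝕜) • riemannSum P 𝕜 g (uniformPartition 0 h N) - g 0 =
      ∑ i ∈ Finset.range (N + 1), L0.const P ((1 / ((N : ℝ) + 1) : ℝ) : 𝕜) •
        (g (0 + (i + 1 : ℕ) * (h / (N + 1))) - g 0) := by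
    simp only [smul_sub, Finset.sum_sub_distrib]
    rw [← Finset.sum_smul, ← L0.const_sum, hone, RCLike.ofReal_one, L0.const_one, one_smul,
      riemannSum_uniformPartition, Finset.smul_sum]
    congr 1
    refine Finset.sum_congr rfl fun i _ => ?_
    rw [smul_smul, ← L0.const_mul, ← RCLike.ofReal_mul]
    congr 3
    field_simp
  have h2 : L0.const P (((h : ℝ)⁻¹ : ℝ) : 𝕜) • riemannSum P 𝕜 g (uniformPartition 0 h N) - g 0 ∈
      elBall P 𝕜 S (ε / 2) (lam / 2) := by
    refine hball _ ?_
    rw [hdiff]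
    calc _ ≤ ∑ i ∈ Finset.range (N + 1),
          ENNReal.ofReal (1 / ((N : ℝ) + 1)) * ENNReal.ofReal d := by
          refine (weightedNorm_sum_le ζ _ _).trans (Finset.sum_le_sum fun i hi => ?_)
          rw [weightedNorm_const_smul ζ (by positivity)]
          gcongr
          have hle : 0 + ((i + 1 : ℕ) : ℝ≥0) * (h / (N + 1)) ≤ h := by
            have h3 : ((i + 1 : ℕ) : ℝ≥0) ≤ N + 1 := by
              exact_mod_cast Finset.mem_range.1 hi
            rw [zero_add, mul_div_assoc', div_le_iff₀ (by positivity), mul_comm]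
            gcongr
          refine hδg _ ⟨zero_le, hle.trans hh1.le⟩ _ ⟨le_rfl, zero_le⟩ ?_
          rw [NNReal.dist_eq, NNReal.coe_zero, sub_zero, abs_of_nonneg (NNReal.coe_nonneg _)]
          exact lt_of_le_of_lt (by exact_mod_cast hle) hh2
      _ = ENNReal.ofReal d := by
          rw [← Finset.sum_mul, ← ENNReal.ofReal_sum_of_nonneg fun i _ => by positivity, hone,
            ENNReal.ofReal_one, one_mul]
  have h4 := add_mem_elBall P 𝕜 (sub_mem_elBall_comm hN) h2
  rwa [sub_add_sub_cancel] at h4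

end Estimates

/-! ### Scalar multiples and differences of bounded operators. -/

section Operators

variable {Ω : Type*} [MeasurableSpace Ω] {P : Measure Ω}
  {𝕜 : Type*} [RCLike 𝕜] {S : Type*} [AddCommGroup S] [Module (L0 P 𝕜) S]
  [RandomNormedModule P 𝕜 S]

/-- The operator `ζ T` for `ζ ∈ L⁰(F, 𝕜)` and `T ∈ B(S)`. -/
def BoundedOperator.smulOp (ζ : L0 P 𝕜) (T : BoundedOperator P 𝕜 S) : BoundedOperator P 𝕜 S where
  toFun x := ζ • T x
  map_zero' := by rw [T.map_zero, smul_zero]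
  map_add' x y := by rw [T.map_add, smul_add]
  map_const_smul' c x := by
    rw [T.map_smul, smul_comm]
  bounded' := by
    obtain ⟨N, hN0, hN⟩ := T.bounded'
    refine ⟨L0.abs ζ * N, ?_, fun x => ?_⟩
    · simpa using L0.mul_le_mul_left (L0.abs_nonneg ζ) hN0
    · rw [l0norm_smul, mul_assoc]
      exact L0.mul_le_mul_left (L0.abs_nonneg ζ) (hN x)

theorem BoundedOperator.smulOp_apply (ζ : L0 P 𝕜) (T : BoundedOperator P 𝕜 S) (x : S) :
    T.smulOp ζ x = ζ • T x := rfl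

/-- The difference of two operators in `B(S)`. -/
def BoundedOperator.subOp (T U : BoundedOperator P 𝕜 S) : BoundedOperator P 𝕜 S where
  toFun x := T x - U x
  map_zero' := by rw [T.map_zero, U.map_zero, sub_zero]
  map_add' x y := by
    rw [T.map_add, U.map_add]
    abel
  map_const_smul' c x := by
    rw [T.map_smul, U.map_smul, smul_sub]
  bounded' := by
    obtain ⟨N, hN0, hN⟩ := T.bounded'
    obtain ⟨N', hN0', hN'⟩ := U.bounded'
    refine ⟨N + N', ?_, fun x => ?_⟩
    · have h := L0.add_le_add_right hN0 N'
      rw [zero_add] at h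
      exact hN0'.trans h
    · rw [sub_eq_add_neg, add_mul]
      refine (l0norm_add_le _ _).trans ?_
      rw [l0norm_neg]
      refine (L0.add_le_add_right (hN x) _).trans ?_
      rw [add_comm, add_comm (N * _)]
      exact L0.add_le_add_right (hN' x) _

theorem BoundedOperator.subOp_apply (T U : BoundedOperator P 𝕜 S) (x : S) :
    T.subOp U x = T x - U x := rfl

theorem ae_mul_l0norm_nonneg {M : L0 P ℝ} (hM : 0 ≤ M) (x : S) :
    ∀ᵐ ω ∂P, 0 ≤ M ω * l0norm P 𝕜 x ω := by
  filter_upwards [ae_l0norm_nonneg (P := P) (𝕜 := 𝕜) x, (L0.le_iff _ _).1 hM,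
    L0.coeFn_zero (P := P) (𝕜 := ℝ)] with ω h1 h2 h3
  rw [h3] at h2
  positivity

end Operators

/-! ### The random exponential factor and its derivative at `0`. -/

section ExpFactor

variable {Ω : Type*} [MeasurableSpace Ω] {P : Measure Ω} (𝕜 : Type*) [RCLike 𝕜]

/-- The random variable `e^{-θ s}`. -/
def expFactor (θ : L0 P ℝ) (s : ℝ≥0) : L0 P 𝕜 := L0.ofReal 𝕜 (L0.exp (-((s : ℝ) • θ)))

variable {𝕜}

theorem L0.coeFn_ofReal (ζ : L0 P ℝ) : ∀ᵐ ω ∂P, L0.ofReal 𝕜 ζ ω = (ζ ω : 𝕜) :=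
  AEEqFun.coeFn_comp _ _ _

theorem ae_expFactor (θ : L0 P ℝ) (s : ℝ≥0) :
    ∀ᵐ ω ∂P, expFactor 𝕜 θ s ω = (Real.exp (-(s * θ ω)) : 𝕜) := by
  filter_upwards [L0.coeFn_ofReal (𝕜 := 𝕜) (L0.exp (-((s : ℝ) • θ))),
    AEEqFun.coeFn_comp Real.exp Real.continuous_exp (-((s : ℝ) • θ)),
    AEEqFun.coeFn_neg ((s : ℝ) • θ), AEEqFun.coeFn_smul (s : ℝ) θ] with ω h1 h2 h3 h4
  rw [expFactor, h1, L0.exp, h2, Function.comp_apply, h3, Pi.neg_apply, h4, Pi.smul_apply,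
    smul_eq_mul]

theorem expFactor_add (θ : L0 P ℝ) (s t : ℝ≥0) :
    expFactor 𝕜 θ (s + t) = expFactor 𝕜 θ s * expFactor 𝕜 θ t := by
  apply AEEqFun.ext
  filter_upwards [ae_expFactor (𝕜 := 𝕜) θ (s + t), ae_expFactor (𝕜 := 𝕜) θ s,
    ae_expFactor (𝕜 := 𝕜) θ t, L0.coeFn_mul (expFactor 𝕜 θ s) (expFactor 𝕜 θ t)]
    with ω h1 h2 h3 h4
  rw [h1, h4, h2, h3, ← RCLike.ofReal_mul, ← Real.exp_add]
  congr 2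
  push_cast
  ring

theorem expFactor_zero (θ : L0 P ℝ) : expFactor 𝕜 θ 0 = 1 := by
  apply AEEqFun.ext
  filter_upwards [ae_expFactor (𝕜 := 𝕜) θ 0, AEEqFun.coeFn_one (μ := P) (β := 𝕜)] with ω h1 h2
  rw [h1, h2]
  simp

theorem expFactor_neg_mul (θ : L0 P ℝ) (s : ℝ≥0) :
    expFactor 𝕜 (-θ) s * expFactor 𝕜 θ s = 1 := by
  apply AEEqFun.ext
  filter_upwards [ae_expFactor (𝕜 := 𝕜) θ s, ae_expFactor (𝕜 := 𝕜) (-θ) s,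
    L0.coeFn_mul (expFactor 𝕜 (-θ) s) (expFactor 𝕜 θ s), AEEqFun.coeFn_neg θ,
    AEEqFun.coeFn_one (μ := P) (β := 𝕜)] with ω h1 h2 h3 h4 h5
  rw [h3, h2, h1, h5, h4, ← RCLike.ofReal_mul, ← Real.exp_add]
  simp

theorem L0.ofReal_neg (θ : L0 P ℝ) : L0.ofReal 𝕜 (-θ) = -L0.ofReal 𝕜 θ := by
  apply AEEqFun.ext
  filter_upwards [L0.coeFn_ofReal (𝕜 := 𝕜) θ, L0.coeFn_ofReal (𝕜 := 𝕜) (-θ),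
    AEEqFun.coeFn_neg θ, AEEqFun.coeFn_neg (L0.ofReal 𝕜 θ)] with ω h1 h2 h3 h4
  rw [h2, h4, h3, Pi.neg_apply, Pi.neg_apply, h1, RCLike.ofReal_neg]

theorem tendsto_expFactor (θ : L0 P ℝ) {s : ℝ≥0} {ns : ℕ → ℝ≥0} (hns : Tendsto ns atTop (𝓝 s)) :
    ∀ᵐ ω ∂P, Tendsto (fun k => expFactor 𝕜 θ (ns k) ω) atTop (𝓝 (expFactor 𝕜 θ s ω)) := by
  filter_upwards [ae_all_iff.2 fun k => ae_expFactor (𝕜 := 𝕜) θ (ns k),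
    ae_expFactor (𝕜 := 𝕜) θ s] with ω h1 h2
  simp only [h1, h2]
  have hc : Continuous fun t : ℝ≥0 => (Real.exp (-(t * θ ω)) : 𝕜) :=
    RCLike.continuous_ofReal.comp (by fun_prop)
  exact (hc.tendsto s).comp hns

/-- For fixed `ω` this is the derivative of `t ↦ e^{-t θ(ω)}` at `0`. Working with a sequence leaves
only countably many exceptional null sets. -/
theorem tendsto_expFactor_slope (θ : L0 P ℝ) {ns : ℕ → ℝ≥0}
    (hns : Tendsto ns atTop (𝓝[>] 0)) :
    ∀ᵐ ω ∂P, Tendsto (fun k => (L0.const P ((((ns k : ℝ≥0) : ℝ)⁻¹ : ℝ) : 𝕜) *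
      (expFactor 𝕜 θ (ns k) - 1)) ω) atTop (𝓝 ((-L0.ofReal 𝕜 θ) ω)) := by
  have h1 : ∀ᵐ ω ∂P, ∀ k, (L0.const P ((((ns k : ℝ≥0) : ℝ)⁻¹ : ℝ) : 𝕜) *
      (expFactor 𝕜 θ (ns k) - 1)) ω =
      (((ns k : ℝ)⁻¹ * (Real.exp (-(ns k * θ ω)) - 1) : ℝ) : 𝕜) := by
    rw [ae_all_iff]
    intro k
    filter_upwards [ae_expFactor (𝕜 := 𝕜) θ (ns k),
      ae_const (P := P) ((((ns k : ℝ≥0) : ℝ)⁻¹ : ℝ) : 𝕜),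
      L0.coeFn_mul (L0.const P ((((ns k : ℝ≥0) : ℝ)⁻¹ : ℝ) : 𝕜)) (expFactor 𝕜 θ (ns k) - 1),
      L0.coeFn_sub (expFactor 𝕜 θ (ns k)) 1, AEEqFun.coeFn_one (μ := P) (β := 𝕜)]
      with ω a1 a2 a3 a4 a5
    rw [a3, a2, a4, a1, a5]
    push_cast
    rfl
  have hns' : Tendsto (fun k => (ns k : ℝ)) atTop (𝓝[≠] 0) := by
    rw [tendsto_nhdsWithin_iff] at hns ⊢
    refine ⟨?_, ?_⟩
    · exact (NNReal.continuous_coe.tendsto 0).comp hns.1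
    · filter_upwards [hns.2] with k hk
      exact (NNReal.coe_pos.2 hk).ne'
  filter_upwards [h1, L0.coeFn_ofReal (𝕜 := 𝕜) θ, AEEqFun.coeFn_neg (L0.ofReal 𝕜 θ)]
    with ω b1 b2 b3
  simp only [b1]
  rw [b3, Pi.neg_apply, b2, ← RCLike.ofReal_neg]
  refine (RCLike.continuous_ofReal.tendsto _).comp ?_
  have hd : HasDerivAt (fun t : ℝ => Real.exp (-(t * θ ω))) (-θ ω) 0 := by
    have := (((hasDerivAt_id (0 : ℝ)).mul_const (θ ω)).neg).exp
    simpa using this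
  have := hd.tendsto_slope_zero.comp hns'
  simpa [Function.comp_def] using this

variable {S : Type*} [AddCommGroup S] [Module (L0 P 𝕜) S] [RandomNormedModule P 𝕜 S]
  [IsProbabilityMeasure P]

/-- The product rule at `0` for difference quotients. -/
theorem elTendsto_expFactor_smul_quotient (θ : L0 P ℝ) {U : ℝ≥0 → S} {u q : S}
    (h : ELTendsto P 𝕜 (fun s : ℝ≥0 => L0.const P (((s : ℝ)⁻¹ : ℝ) : 𝕜) • (U s - u))
      (𝓝[>] 0) q) :
    ELTendsto P 𝕜 (fun s : ℝ≥0 => L0.const P (((s : ℝ)⁻¹ : ℝ) : 𝕜) •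
      (expFactor 𝕜 θ s • U s - u)) (𝓝[>] 0) (q - L0.ofReal 𝕜 θ • u) := by
  -- Split `e^{-θ s} U(s) - u = e^{-θ s} (U(s) - u) + (e^{-θ s} - 1) u` and pass to the limit in
  -- each term after division by `s`.
  have h1 := ELTendsto.smul_of_ae (ζ := expFactor 𝕜 θ) (ζ₀ := expFactor 𝕜 θ 0)
    (fun ns hns => tendsto_expFactor θ (tendsto_nhds_of_tendsto_nhdsWithin hns)) h
  have h2 := ELTendsto.smul_of_ae (l := 𝓝[>] (0 : ℝ≥0))
    (ζ := fun s : ℝ≥0 => L0.const P (((s : ℝ)⁻¹ : ℝ) : 𝕜) * (expFactor 𝕜 θ s - 1))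
    (fun ns hns => tendsto_expFactor_slope (𝕜 := 𝕜) θ hns) (elTendsto_const (P := P) (𝕜 := 𝕜) _ u)
  have h3 := h1.add h2
  rw [expFactor_zero, one_smul, neg_smul, ← sub_eq_add_neg] at h3
  refine h3.congr fun s => ?_
  rw [smul_comm (expFactor 𝕜 θ s), mul_smul, ← smul_add, smul_sub, sub_smul, one_smul]
  congr 1
  abel

end ExpFactor

/-! ### The damped semigroup, its Laplace integral and the resolvent equation. -/

section DampedSemigroup

variable {Ω : Type*} [MeasurableSpace Ω] {P : Measure Ω} [IsProbabilityMeasure P]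
  {𝕜 : Type*} [RCLike 𝕜] {S : Type*} [AddCommGroup S] [Module (L0 P 𝕜) S]
  [RandomNormedModule P 𝕜 S] {C : BoundedOperator P 𝕜 S} {W : ℝ≥0 → BoundedOperator P 𝕜 S}
  {M ξ η : L0 P ℝ}

/-- The family `e^{-η s} W(s)`. -/
def damped (W : ℝ≥0 → BoundedOperator P 𝕜 S) (η : L0 P ℝ) (s : ℝ≥0) : BoundedOperator P 𝕜 S :=
  (W s).smulOp (expFactor 𝕜 η s)

theorem damped_zero (hW : IsCSemigroup C W) (x : S) : damped W η 0 x = C x := by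
  rw [damped, BoundedOperator.smulOp_apply, expFactor_zero, one_smul, hW.zero]

theorem damped_damped (hW : IsCSemigroup C W) (s t : ℝ≥0) (x : S) :
    damped W η t (damped W η s x) = C (damped W η (s + t) x) := by
  simp only [damped, BoundedOperator.smulOp_apply, BoundedOperator.map_smul, expFactor_add,
    hW.comp_add, smul_smul]

theorem damped_comm (hW : IsCSemigroup C W) (s t : ℝ≥0) (x : S) :
    damped W η t (damped W η s x) = damped W η s (damped W η t x) := by
  rw [damped_damped hW, damped_damped hW, add_comm]

theorem damped_apply_C (hW : IsCSemigroup C W) (s : ℝ≥0) (x : S) :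
    damped W η s (C x) = C (damped W η s x) := by
  rw [← damped_zero (η := η) hW x, damped_damped hW, zero_add]

theorem continuous_damped (hW : IsCSemigroup C W) (x : S) :
    @Continuous ℝ≥0 S _ (elTopology P 𝕜 S) (fun s => damped W η s x) := by
  let _ := elTopology P 𝕜 S
  rw [continuous_iff_continuousAt]
  intro s
  have h : ELTendsto P 𝕜 (fun t => W t x) (𝓝 s) (W s x) := (hW.strongly_continuous x).tendsto s
  exact ELTendsto.smul_of_ae (fun ns hns => tendsto_expFactor η hns) h

theorem ae_damped_le (hW : W ∈ H C M ξ) (s : ℝ≥0) (x : S) :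
    ∀ᵐ ω ∂P, l0norm P 𝕜 (damped W η s x) ω ≤
      Real.exp (-(s * (η ω - ξ ω))) * (M ω * l0norm P 𝕜 x ω) := by
  filter_upwards [ae_l0norm_smul (P := P) (expFactor 𝕜 η s) (W s x), ae_expFactor (𝕜 := 𝕜) η s,
    (W s).ae_norm_le x, (L0.le_iff _ _).1 (hW.2 s), L0.coeFn_mul M (L0.exp ((s : ℝ) • ξ)),
    AEEqFun.coeFn_comp Real.exp Real.continuous_exp ((s : ℝ) • ξ), AEEqFun.coeFn_smul (s : ℝ) ξ,
    ae_l0norm_nonneg (P := P) (𝕜 := 𝕜) x] with ω h1 h2 h3 h4 h5 h6 h7 h8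
  rw [damped, BoundedOperator.smulOp_apply, h1, h2, RCLike.norm_ofReal,
    abs_of_pos (Real.exp_pos _)]
  rw [h5, L0.exp, h6, Function.comp_apply, h7, Pi.smul_apply, smul_eq_mul] at h4
  have h9 : Real.exp (-(s * (η ω - ξ ω))) = Real.exp (-(s * η ω)) * Real.exp (s * ξ ω) := by
    rw [← Real.exp_add]
    congr 1
    ring
  rw [h9]
  calc _ ≤ Real.exp (-(s * η ω)) * ((M ω * Real.exp (s * ξ ω)) * l0norm P 𝕜 x ω) := by
        gcongr
        exact h3.trans (by gcongr)
    _ = _ := by ring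

theorem ae_damped_le_const (hM : 0 ≤ M) (hW : W ∈ H C M ξ) (hη : η ∈ L0.G ξ) (x : S) (s : ℝ≥0) :
    ∀ᵐ ω ∂P, l0norm P 𝕜 (damped W η s x) ω ≤ (M * l0norm P 𝕜 x) ω := by
  filter_upwards [ae_damped_le (η := η) hW s x, hη, L0.coeFn_mul M (l0norm P 𝕜 x),
    ae_l0norm_nonneg (P := P) (𝕜 := 𝕜) x, (L0.le_iff _ _).1 hM,
    L0.coeFn_zero (P := P) (𝕜 := ℝ)] with ω h1 h2 h3 h4 h5 h6
  rw [h6] at h5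
  rw [h3]
  refine h1.trans (mul_le_of_le_one_left (by positivity) ?_)
  rw [Real.exp_le_one_iff, neg_nonpos]
  exact mul_nonneg s.coe_nonneg (sub_nonneg.2 h2.le)

theorem ae_integral_damped_le (hM : 0 ≤ M) (hW : W ∈ H C M ξ) (hη : η ∈ L0.G ξ) {x J : S}
    {a c : ℝ≥0} (hJ : HasRiemannIntegral P 𝕜 (fun s => damped W η s x) a (a + c) J) :
    ∀ᵐ ω ∂P, l0norm P 𝕜 J ω ≤
      Real.exp (-(a * (η ω - ξ ω))) * (M ω * l0norm P 𝕜 x ω / (η ω - ξ ω)) :=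
  hJ.ae_norm_le_exp
    (Eventually.mono (show ∀ᵐ ω ∂P, ξ ω < η ω from hη) fun _ h => sub_pos.2 h)
    (ae_mul_l0norm_nonneg hM x)
    (fun s => ae_damped_le hW s x)

theorem exists_integral_damped (hS : IsELComplete P 𝕜 S) (hM : 0 ≤ M) (hW : W ∈ H C M ξ)
    (hη : η ∈ L0.G ξ) (x : S) (a c : ℝ≥0) :
    ∃ J, HasRiemannIntegral P 𝕜 (fun s => damped W η s x) a (a + c) J :=
  exists_hasRiemannIntegral hS (continuous_damped hW.1 x) (ae_damped_le_const hM hW hη x) a c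

theorem integral_damped_add (hS : IsELComplete P 𝕜 S) (hM : 0 ≤ M) (hW : W ∈ H C M ξ)
    (hη : η ∈ L0.G ξ) {x : S} {J : ℝ≥0 → S}
    (hJ : ∀ b, HasRiemannIntegral P 𝕜 (fun s => damped W η s x) 0 b (J b)) (b c : ℝ≥0) :
    HasRiemannIntegral P 𝕜 (fun s => damped W η s x) b (b + c) (J (b + c) - J b) := by
  obtain ⟨K, hK⟩ := exists_integral_damped hS hM hW hη x b c
  have h0 : (0 : ℝ≥0) + b = b := zero_add b
  have h := HasRiemannIntegral.unique_add (a := 0) (c := b) (d := c) (J := J (b + c)) (J₁ := J b)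
    (J₂ := K) (by rw [h0]; exact hJ _) (by rw [h0]; exact hJ _) (by rw [h0]; exact hK)
  rwa [h, add_sub_cancel_left]

/-- The integral between `b` and `c` is bounded by a random constant times `e^{-min(b, c) (η - ξ)}`.
For almost every `ω` this tends to `0`, the rate being a positive number, so the integrals over `[0,
b]` form a Cauchy net. -/
theorem exists_improper_damped (hS : IsELComplete P 𝕜 S) (hM : 0 ≤ M) (hW : W ∈ H C M ξ)
    (hη : η ∈ L0.G ξ) (x : S) :
    ∃ I, HasImproperIntegral P 𝕜 (fun s => damped W η s x) I := by
  have hex : ∀ b, ∃ J, HasRiemannIntegral P 𝕜 (fun s => damped W η s x) 0 b J := by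
    intro b
    have h := exists_integral_damped hS hM hW hη x 0 b
    rwa [zero_add] at h
  choose J hJ using hex
  have hle : ∀ q : ℝ≥0 × ℝ≥0, ∀ᵐ ω ∂P, l0norm P 𝕜 (J q.2 - J q.1) ω ≤
      Real.exp (-((min q.1 q.2 : ℝ≥0) * (η ω - ξ ω))) *
        (M ω * l0norm P 𝕜 x ω / (η ω - ξ ω)) := by
    rintro ⟨b, c⟩
    rcases le_total b c with h | h
    · obtain ⟨d, rfl⟩ := exists_add_of_le h
      rw [min_eq_left h]
      exact ae_integral_damped_le hM hW hη (integral_damped_add hS hM hW hη hJ b d)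
    · obtain ⟨d, rfl⟩ := exists_add_of_le h
      rw [min_eq_right h, l0norm_sub_rev]
      exact ae_integral_damped_le hM hW hη (integral_damped_add hS hM hW hη hJ c d)
  have hzero : ELTendsto P 𝕜 (fun q : ℝ≥0 × ℝ≥0 => J q.2 - J q.1) (atTop ×ˢ atTop) 0 := by
    refine elTendsto_zero_of_ae_le _ hle ?_
    filter_upwards [hη] with ω hω
    have hmin : Tendsto (fun q : ℝ≥0 × ℝ≥0 => ((min q.1 q.2 : ℝ≥0) : ℝ)) (atTop ×ˢ atTop) atTop :=
      NNReal.tendsto_coe_atTop.2 <| tendsto_atTop.2 fun B => by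
        filter_upwards [tendsto_fst.eventually_ge_atTop B, tendsto_snd.eventually_ge_atTop B]
          with q h1 h2 using le_min h1 h2
    have h1 := (hmin.atTop_mul_const (sub_pos.2 hω))
    have h2 := (Real.tendsto_exp_neg_atTop_nhds_zero.comp h1).mul_const
      (M ω * l0norm P 𝕜 x ω / (η ω - ξ ω))
    rwa [zero_mul] at h2
  have hC : @Cauchy S (elUniformSpace P 𝕜 S) (map J atTop) := by
    rw [@cauchy_map_iff _ _ (elUniformSpace P 𝕜 S)]
    refine ⟨inferInstance, ?_⟩
    rw [elUniformity_eq_comap, tendsto_comap_iff]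
    exact hzero
  obtain ⟨I, hI⟩ := hS.complete hC
  exact ⟨I, J, hJ, hI⟩

theorem ae_improper_damped_le (hM : 0 ≤ M) (hW : W ∈ H C M ξ) (hη : η ∈ L0.G ξ) {x I : S}
    (hI : HasImproperIntegral P 𝕜 (fun s => damped W η s x) I) :
    ∀ᵐ ω ∂P, l0norm P 𝕜 I ω ≤ M ω / (η ω - ξ ω) * l0norm P 𝕜 x ω := by
  obtain ⟨J, hJ, hI⟩ := hI
  refine hI.ae_norm_le _ (Eventually.of_forall fun b => ?_)
  have h := hJ b
  rw [← zero_add b] at h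
  filter_upwards [ae_integral_damped_le hM hW hη h] with ω h1
  rw [zero_add] at h1
  refine h1.trans (le_of_eq ?_)
  rw [NNReal.coe_zero, zero_mul, neg_zero, Real.exp_zero, one_mul]
  ring

theorem HasImproperIntegral.map {g : ℝ≥0 → S} {I : S} (h : HasImproperIntegral P 𝕜 g I)
    (T : BoundedOperator P 𝕜 S) : HasImproperIntegral P 𝕜 (fun s => T (g s)) (T I) := by
  obtain ⟨J, hJ, hI⟩ := h
  exact ⟨fun b => T (J b), fun b => (hJ b).map T, hI.map T⟩

/-- `V(h) ∫_0^b V(s) x ds = C ∫_h^{b + h} V(s) x ds` for `V(s) = e^{-η s} W(s)`. -/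
theorem damped_integral (hS : IsELComplete P 𝕜 S) (hM : 0 ≤ M) (hW : W ∈ H C M ξ)
    (hη : η ∈ L0.G ξ) {x : S} {J : ℝ≥0 → S}
    (hJ : ∀ b, HasRiemannIntegral P 𝕜 (fun s => damped W η s x) 0 b (J b)) (b h : ℝ≥0) :
    damped W η h (J b) = C (J (h + b) - J h) := by
  have hb := hJ b
  rw [← zero_add b] at hb
  have h1 := (hb.map (damped W η h)).tendsto_uniform
  have h2 := ((integral_damped_add hS hM hW hη hJ h b).map C).tendsto_uniform
  rw [zero_add] at h1
  refine h1.unique (h2.congr fun N => ?_)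
  -- The uniform partition of `[h, h + b]` is the translate of that of `[0, b]`, so the two sums
  -- agree term by term.
  rw [riemannSum_uniformPartition, riemannSum_uniformPartition]
  refine Finset.sum_congr rfl fun i _ => ?_
  rw [damped_damped hW.1, zero_add, add_comm h]

/-- Let `b → ∞` in `damped_integral`: both `J b` and `J (h + b)` tend to `I`. -/
theorem damped_improper (hS : IsELComplete P 𝕜 S) (hM : 0 ≤ M) (hW : W ∈ H C M ξ)
    (hη : η ∈ L0.G ξ) {x I : S} {J : ℝ≥0 → S}
    (hJ : ∀ b, HasRiemannIntegral P 𝕜 (fun s => damped W η s x) 0 b (J b))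
    (hI : ELTendsto P 𝕜 J atTop I) (h : ℝ≥0) : damped W η h I - C I = -C (J h) := by
  have h1 := hI.map (damped W η h)
  have h2 := ((hI.comp (u := fun b => h + b)
    (tendsto_atTop_mono (fun _ => le_add_self) tendsto_id)).sub
    (elTendsto_const (P := P) (𝕜 := 𝕜) atTop (J h))).map C
  have h3 := h1.unique (h2.congr fun b => (damped_integral hS hM hW hη hJ b h).symm)
  rw [h3, BoundedOperator.map_sub]
  abel

/-- By `damped_improper` the quotient is `-C` applied to the average of `V(s) x` over `[0, s]`, and
these averages tend to `V(0) x = C x`. -/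
theorem tendsto_damped_improper_quotient (hS : IsELComplete P 𝕜 S) (hM : 0 ≤ M)
    (hW : W ∈ H C M ξ) (hη : η ∈ L0.G ξ) {x I : S}
    (hI : HasImproperIntegral P 𝕜 (fun s => damped W η s x) I) :
    ELTendsto P 𝕜 (fun s : ℝ≥0 => L0.const P (((s : ℝ)⁻¹ : ℝ) : 𝕜) • (damped W η s I - C I))
      (𝓝[>] 0) (-C (C x)) := by
  obtain ⟨J, hJ, hI⟩ := hI
  have h := ((elTendsto_average (continuous_damped hW.1 x) (ae_damped_le_const hM hW hη x)
    hJ).map C).neg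
  rw [damped_zero hW.1] at h
  refine h.congr fun s => ?_
  rw [damped_improper hS hM hW hη hJ hI, BoundedOperator.map_smul, smul_neg]

theorem etaSub_improper (hS : IsELComplete P 𝕜 S) (hM : 0 ≤ M)
    (hW : W ∈ H C M ξ) (hη : η ∈ L0.G ξ) {x I : S}
    (hI : HasImproperIntegral P 𝕜 (fun s => damped W η s x) I) :
    ∃ hmem : I ∈ (generator hW.1).domain,
      etaSub (L0.ofReal 𝕜 η) (generator hW.1) ⟨I, hmem⟩ = C x := by
  -- The product rule with the factor `e^{η s}` removes the damping and returns to the quotients of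
  -- `W`.
  have h1 := elTendsto_expFactor_smul_quotient (-η)
    (tendsto_damped_improper_quotient hS hM hW hη hI)
  have hq : HasQuotientLimit C W I (C (L0.ofReal 𝕜 η • I - C x)) := by
    have he : -C (C x) - L0.ofReal 𝕜 (-η) • C I = C (L0.ofReal 𝕜 η • I - C x) := by
      rw [BoundedOperator.map_sub, BoundedOperator.map_smul, L0.ofReal_neg, neg_smul]
      abel
    rw [he] at h1
    refine h1.congr fun s => ?_
    rw [damped, BoundedOperator.smulOp_apply, smul_smul, expFactor_neg_mul, one_smul]
  refine ⟨⟨_, hq⟩, ?_⟩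
  have h2 : generator hW.1 ⟨I, ⟨_, hq⟩⟩ = L0.ofReal 𝕜 η • I - C x :=
    hW.1.injective ((generator_spec hW.1 ⟨I, ⟨_, hq⟩⟩).unique hq)
  rw [etaSub, h2, sub_sub_cancel]

/-- The quotient of `V` at the Laplace integral of `z` has two limits: `-C C z` by the fundamental
identity, and `0` because the quotient can be moved under the integral onto `z`, where it tends to
`C A z - η C z = 0`. Thus no orbit has to be differentiated away from `0`. -/
theorem eq_zero_of_generator_eq_smul (hS : IsELComplete P 𝕜 S) (hM : 0 ≤ M)
    (hW : W ∈ H C M ξ) (hη : η ∈ L0.G ξ) (z : (generator hW.1).domain)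
    (hz : generator hW.1 z = L0.ofReal 𝕜 η • (z : S)) : (z : S) = 0 := by
  obtain ⟨I, hI⟩ := exists_improper_damped hS hM hW hη (z : S)
  let T : ℝ≥0 → BoundedOperator P 𝕜 S := fun h =>
    ((damped W η h).subOp C).smulOp (L0.const P (((h : ℝ)⁻¹ : ℝ) : 𝕜))
  have h1 : ELTendsto P 𝕜 (fun h => T h (z : S)) (𝓝[>] 0) 0 := by
    have h := elTendsto_expFactor_smul_quotient η (generator_spec hW.1 z)
    rw [hz, BoundedOperator.map_smul, sub_self] at h
    exact h
  -- `T h I` is the improper integral of `V(s) T_h z`, since `T_h` is bounded and commutes with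
  -- `V(s)`; the resulting factor `M / (η - ξ)` does not depend on `h`.
  have h2 : ELTendsto P 𝕜 (fun h => T h I) (𝓝[>] 0) 0 := by
    refine elTendsto_of_ae_le (fun ω => M ω / (η ω - ξ ω)) (fun h => ?_) h1
    simp only [sub_zero]
    refine ae_improper_damped_le hM hW hη (x := T h z) ?_
    have h3 : (fun s => damped W η s (T h z)) = fun s => T h (damped W η s z) := by
      funext s
      simp only [T, BoundedOperator.smulOp_apply, BoundedOperator.subOp_apply,
        BoundedOperator.map_smul, BoundedOperator.map_sub, damped_apply_C hW.1]
      rw [damped_comm hW.1]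
    rw [h3]
    exact hI.map (T h)
  have h3 : -C (C (z : S)) = 0 :=
    (tendsto_damped_improper_quotient hS hM hW hη hI).unique h2
  have h4 : C (C (z : S)) = C (C 0) := by
    rw [neg_eq_zero.1 h3, BoundedOperator.map_zero, BoundedOperator.map_zero]
  exact hW.1.injective (hW.1.injective h4)

theorem injective_etaSub_generator (hS : IsELComplete P 𝕜 S) (hM : 0 ≤ M)
    (hW : W ∈ H C M ξ) (hη : η ∈ L0.G ξ) :
    Function.Injective (etaSub (L0.ofReal 𝕜 η) (generator hW.1)) := by
  intro x y hxy
  have h : generator hW.1 (x - y) = L0.ofReal 𝕜 η • ((x - y : (generator hW.1).domain) : S) := by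
    unfold etaSub at hxy
    rw [LinearPMap.map_sub, Submodule.coe_sub, smul_sub, eq_comm, sub_eq_sub_iff_sub_eq_sub]
    exact hxy
  have h0 := eq_zero_of_generator_eq_smul hS hM hW hη _ h
  rw [Submodule.coe_sub, sub_eq_zero] at h0
  exact Subtype.ext h0

theorem mem_cResolventSet_generator (hS : IsELComplete P 𝕜 S) (hM : 0 ≤ M)
    (hW : W ∈ H C M ξ) (hη : η ∈ L0.G ξ) :
    L0.ofReal 𝕜 η ∈ cResolventSet C (generator hW.1) := by
  refine ⟨injective_etaSub_generator hS hM hW hη, ?_⟩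
  rintro _ ⟨x, rfl⟩
  obtain ⟨I, hI⟩ := exists_improper_damped hS hM hW hη x
  obtain ⟨hmem, h⟩ := etaSub_improper hS hM hW hη hI
  exact ⟨_, h⟩

end DampedSemigroup

end RandomModule

end

/-! ### The Laplace representation of the `C`-resolvent. -/

theorem lemma4p6 {Ω : Type*} [MeasurableSpace Ω] (P : MeasureTheory.Measure Ω)
    [MeasureTheory.IsProbabilityMeasure P] {𝕜 : Type*} [RCLike 𝕜]
    {S : Type*} [AddCommGroup S] [Module (RandomModule.L0 P 𝕜) S]
    [RandomModule.RandomNormedModule P 𝕜 S] (hS : RandomModule.IsELComplete P 𝕜 S)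
    (C : RandomModule.BoundedOperator P 𝕜 S) (M ξ : RandomModule.L0 P ℝ) (hM : 0 ≤ M)
    (W : ℝ≥0 → RandomModule.BoundedOperator P 𝕜 S) (hW : W ∈ RandomModule.H C M ξ)
    (η : RandomModule.L0 P ℝ) (hη : η ∈ RandomModule.L0.G ξ) :
    ∃ h : RandomModule.L0.ofReal 𝕜 η ∈
        RandomModule.cResolventSet C (RandomModule.generator hW.1),
      ∀ x : S, RandomModule.HasLaplaceTransformAt P 𝕜 (fun s => W s x) η
        (RandomModule.cResolvent h x) := by
  have hmem := RandomModule.mem_cResolventSet_generator hS hM hW hη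
  refine ⟨hmem, fun x => ?_⟩
  obtain ⟨I, hI⟩ := RandomModule.exists_improper_damped hS hM hW hη x
  obtain ⟨hd, h⟩ := RandomModule.etaSub_improper hS hM hW hη hI
  obtain ⟨hd', h'⟩ := RandomModule.cResolvent_spec hmem x
  -- The resolvent is defined by choosing a preimage of `C x`; injectivity of `η - A` identifies the
  -- choice with the integral.
  have heq : RandomModule.cResolvent hmem x = I :=
    congrArg Subtype.val (hmem.1 (h'.trans h.symm))
  rw [heq]
  exact hI
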